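/- Let $K$ be a non-archimedean local field with valuation $v$, normalized so that a prime element has valuation $1$ (and $v(0)=\infty$). Let $V$ be a $K$-vector space of dimension $n\ge 1$ with a fixed basis $v_1,\dots,v_n$, and let $G=PGL(V)=GL(V)/K^\times$ with its natural topology. Let $T\subset G$ be the torus of (classes of) diagonal matrices and $N$ the normalizer of $T$ in $G$; $N$ consists of the classes of the monomial matrices $tw$ with $t=\mathrm{diag}(d_1,\dots,d_n)$ and $w$ a permutation matrix, $w(v_i)=v_{w(i)}$. For non-empty $I\subseteq\underline n=\{1,\dots,n\}$ let $A_I$ be the real vector space generated by elements $\eta_i^I$ $(i\in I)$ subject to the single relation $\sum_{i\in I}\eta_i^I=0$. Put $A=A_{\underline n}$, $\eta_i=\eta_i^{\underline n}$, and let $s_I:A\to A_I$ be the linear map with $\eta_i\mapsto\eta_i^I$ for $i\in I$ and $\eta_i\mapsto 0$ for $i\notin I$. Let $\overline A=\bigsqcup_{\emptyset\ne I\subseteq\underline n}A_I$, with the topology generated by the open subsets of $A$ and by the sets $$\Gamma_U^I=(U+\Delta_I)\cup\bigcup_{I\subseteq J\subsetneq\underline n}s_J(U+\Delta_I),\qquad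 \Delta_I=\sum_{i\notin I}\mathbb R_{\ge0}\,\eta_i,$$ for $\emptyset\neq I\subsetneq\underline n$ and $U\subset A$ open and bounded. The group $N$ acts on $\overline A$ by $\nu$, where $\nu(tw)$, with $t=\mathrm{diag}(d_1,\dots,d_n)$, maps $\sum_{i\in I}x_i\eta^I_i\in A_I$ to $\sum_{i\in I}\bigl(x_i-v(d_{w(i)})\bigr)\eta^{w(I)}_{w(i)}\in A_{w(I)}$. Let $Z\subset T$ be the kernel of $T\to A$, $\mathrm{diag}(d_1,\dots,d_n)\mapsto\sum_i -v(d_i)\eta_i$. For $i\ne j$ let $a=a_{ij}$ be the root with $a(\sum_k x_k\eta_k)=x_i-x_j$, let $U_a$ be its root group (the unipotent matrices $u$ whose only non-zero off-diagonal entry is $u_{ij}$), and for $l\in\mathbb R\cup\{\pm\infty\}$ put $U_{a,l}=\{u\in U_a: v(u_{ij})\ge l\}$. For $x\in\overline A$ put $$f_x(a)=\inf\{t\in\mathbb R: x\in\overline{\{z\in A:a(z)\ge -t\}}\}\in\mathbb R\cup\{\pm\infty\}$$ (closure in $\overline A$; $f_x(a)=-a(x)$ for $x\in A$). Let $U_x\subset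 G$ be the subgroup generated by all $U_{a,f_x(a)}$, let $N_x=\{m\in N:\nu(m)x=x\}$, $P_x=U_xN_x$, and $U_0^\wedge=U_0Z$ for the point $0\in A$. The Bruhat–Tits building is $X=(G\times A)/\!\sim$ and its compactification is $\overline X=(U_0^\wedge\times\overline A)/\!\sim$, both with the quotient topology, where in both cases $$(g,x)\sim(h,y)\iff \text{there is } m\in N \text{ with } \nu(m)x=y \text{ and } g^{-1}hm\in P_x .$$ **Theorem.** The topological space $\overline X$ is compact (and Hausdorff) and contractible, and it contains the building $X$ as an open dense subset: there is a homeomorphism $j$ from $X$ onto an open dense subspace of $\overline X$, namely onto the image of $U_0^\wedge\times A$ in $\overline X$, which sends the class of $(u,x)$ in $X$ to the class of $(u,x)$ in $\overline X$ for all $u\in U_0^\wedge$ and $x\in A$. -/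

import Mathlib

open Topology
open scoped Pointwise

namespace BTCompactification

noncomputable section

/-! ### The local field and its normalized valuation -/

section Valuation

variable {K : Type*} [Field K] [ValuativeRel K] [TopologicalSpace K]
  [IsNonarchimedeanLocalField K]

/-- The normalized valuation on nonzero elements: integer valued, equal to `1` on prime elements.
(The order isomorphism of the value group with the integers is unique.) At `0` it has the junk
value `0`. -/
def vInt (x : K) : ℤ :=
  -WithZero.log (IsNonarchimedeanLocalField.valueGroupWithZeroIsoInt K
    (ValuativeRel.valuation K x))

open Classical in
/-- The normalized valuation `v`, with `v 0 = ∞`. -/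
def v (x : K) : EReal := if x = 0 then ⊤ else (((vInt x : ℤ) : ℝ) : EReal)

lemma vInt_mul {x y : K} (hx : x ≠ 0) (hy : y ≠ 0) : vInt (x * y) = vInt x + vInt y := by
  unfold vInt
  rw [map_mul, map_mul, WithZero.log_mul (by simpa using hx) (by simpa using hy)]
  ring

/-- A local field is infinite. -/
lemma infinite_localField : Infinite K := by
  obtain ⟨x, hx0, hx1⟩ :=
    Valuation.IsNontrivial.exists_lt_one (v := ValuativeRel.valuation K)
  have hanti : StrictAnti fun m : ℕ => (ValuativeRel.valuation K x) ^ m :=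
    pow_right_strictAnti₀ (zero_lt_iff.2 ((Valuation.ne_zero_iff _).2 hx0)) hx1
  refine Infinite.of_injective (fun m : ℕ => x ^ m) fun a c h => ?_
  exact hanti.injective (by simpa using congrArg (ValuativeRel.valuation K) h)

end Valuation

/-! ### The group `PGL(V)` with its topology -/

section PGL

variable (K : Type*) [Field K] (V : Type*) [AddCommGroup V] [Module K V]

/-- `PGL(V) = GL(V) / center`. -/
def PGL : Type _ :=
  LinearMap.GeneralLinearGroup K V ⧸ Subgroup.center (LinearMap.GeneralLinearGroup K V)

instance : Group (PGL K V) :=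
  inferInstanceAs
    (Group (LinearMap.GeneralLinearGroup K V ⧸
      Subgroup.center (LinearMap.GeneralLinearGroup K V)))

variable {K V} in
/-- The projection `GL(V) → PGL(V)`. -/
def PGL.mk : LinearMap.GeneralLinearGroup K V →* PGL K V :=
  QuotientGroup.mk' (Subgroup.center (LinearMap.GeneralLinearGroup K V))

/-- The topology of `GL(V)` as the group of units of `End(V)`, where the finite dimensional
vector space `End(V)` carries its canonical topology. -/
@[reducible] def glTopology [TopologicalSpace K] :
    TopologicalSpace (LinearMap.GeneralLinearGroup K V) :=
  letI : TopologicalSpace (V →ₗ[K] V) := moduleTopology K (V →ₗ[K] V)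
  Units.instTopologicalSpaceUnits

/-- `PGL(V)` carries the quotient topology. -/
instance [TopologicalSpace K] : TopologicalSpace (PGL K V) :=
  TopologicalSpace.coinduced (PGL.mk : _ → PGL K V) (glTopology K V)

end PGL

/-! ### The apartment `A` and its pieces `A_I` -/

section Apartment

/-- The functions `{1, …, n} → ℝ` that are constant on `I`, i.e. (for non-empty `I`) the span of
`(1, …, 1)` and of the standard basis vectors `e_i` with `i ∉ I`. -/
def constOn {n : ℕ} (I : Finset (Fin n)) : Submodule ℝ (Fin n → ℝ) where
  carrier := {x | ∀ i ∈ I, ∀ j ∈ I, x i = x j}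
  add_mem' hx hy i hi j hj := by simp [hx i hi j hj, hy i hi j hj]
  zero_mem' _ _ _ _ := rfl
  smul_mem' c x hx i hi j hj := by simp [hx i hi j hj]

/-- The real vector space `A_I`: it is generated by cocharacters `η_i` (`i ∈ I`) with the single
relation `∑_{i ∈ I} η_i = 0`. It is realized as the quotient of `ℝⁿ` by `(1, …, 1)` and the `e_i`
with `i ∉ I`; the class of `x` is `∑_{i ∈ I} x_i η_i`. -/
abbrev Apt {n : ℕ} (I : Finset (Fin n)) : Type := (Fin n → ℝ) ⧸ constOn I

variable {n : ℕ}

/-- The point `∑_{i ∈ I} x_i η_i` of `A_I`. -/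
def Apt.mk (I : Finset (Fin n)) : (Fin n → ℝ) →ₗ[ℝ] Apt I := (constOn I).mkQ

variable (n) in
/-- The fundamental apartment `A = A_{1, …, n}`, of dimension `n - 1`. -/
abbrev A : Type := Apt (Finset.univ : Finset (Fin n))

/-- The class of `x` in `A`, i.e. `∑ x_i η_i`. -/
abbrev A.mk : (Fin n → ℝ) →ₗ[ℝ] A n := Apt.mk Finset.univ

/-- The surjection `s_I : A → A_I`: it sends `η_i` to `η_i` if `i ∈ I` and to `0` otherwise. -/
def s (I : Finset (Fin n)) : A n →ₗ[ℝ] Apt I :=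
  (constOn Finset.univ).mapQ (constOn I) LinearMap.id
    (fun _ hx i _ j _ => hx i (Finset.mem_univ i) j (Finset.mem_univ j))

/-- The root `a_{ij}` as a linear form on `A`: it sends `∑ x_k η_k` to `x_i - x_j`. -/
def root (i j : Fin n) : A n →ₗ[ℝ] ℝ :=
  (constOn Finset.univ).liftQ
    ((LinearMap.proj i : (Fin n → ℝ) →ₗ[ℝ] ℝ) - (LinearMap.proj j : (Fin n → ℝ) →ₗ[ℝ] ℝ))
    (fun _ hx => by
      exact sub_eq_zero.2 (hx i (Finset.mem_univ i) j (Finset.mem_univ j)))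

variable (n) in
/-- The compactified apartment: the disjoint union of the `A_I` for non-empty `I`. -/
def ABar : Type := Σ I : {I : Finset (Fin n) // I.Nonempty}, Apt I.1

/-- The inclusion of the piece `A_I`. -/
def ABar.incl (I : Finset (Fin n)) (hI : I.Nonempty) (x : Apt I) : ABar n := ⟨⟨I, hI⟩, x⟩

/-- The inclusion `A → ABar`. -/
def ABar.ofA [NeZero n] (x : A n) : ABar n := ABar.incl Finset.univ Finset.univ_nonempty x

/-- The cone `Δ_I = ∑_{i ∉ I} ℝ_{≥ 0} η_i` in `A`. -/
def Delta (I : Finset (Fin n)) : Set (A n) :=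
  {z | ∃ c : Fin n → ℝ, (∀ i, 0 ≤ c i) ∧ (∀ i ∈ I, c i = 0) ∧ z = A.mk c}

/-- The sets `Γ_U^I = (U + Δ_I) ∪ ⋃_{I ⊆ J ⊂ {1, …, n}} s_J (U + Δ_I)`. -/
def Gam [NeZero n] (I : Finset (Fin n)) (U : Set (A n)) : Set (ABar n) :=
  ABar.ofA '' (U + Delta I) ∪
    {p | ∃ (J : Finset (Fin n)) (hJ : J.Nonempty), I ⊆ J ∧ J ≠ Finset.univ ∧
      ∃ z ∈ U + Delta I, p = ABar.incl J hJ (s J z)}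

/-- The topology of the compactified apartment: it is generated by the open subsets of `A`
and the `Γ_U^I`, for non-empty proper subsets `I` and bounded open subsets `U` of `A`. -/
instance [NeZero n] : TopologicalSpace (ABar n) :=
  TopologicalSpace.generateFrom
    ({O | ∃ U : Set (A n), IsOpen U ∧ O = ABar.ofA '' U} ∪
      {O | ∃ (I : Finset (Fin n)) (U : Set (A n)), I.Nonempty ∧ I ≠ Finset.univ ∧
        IsOpen U ∧ Bornology.IsBounded U ∧ O = Gam I U})

end Apartment

/-! ### The torus `T`, its normalizer `N`, and the action of `N` on the compactified apartment -/

section Monomial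

variable {K : Type*} [Field K] {V : Type*} [AddCommGroup V] [Module K V] {n : ℕ}
  (b : Module.Basis (Fin n) K V)

/-- The element of `GL(V)` mapping `v_i` to `d_{w(i)} v_{w(i)}`, i.e. the product of the diagonal
matrix with entries `d` and the permutation matrix of `w`. -/
def monoGL (d : Fin n → Kˣ) (w : Equiv.Perm (Fin n)) : LinearMap.GeneralLinearGroup K V :=
  LinearMap.GeneralLinearGroup.ofLinearEquiv (b.equiv (b.unitsSMul d) w)

lemma monoGL_apply (d : Fin n → Kˣ) (w : Equiv.Perm (Fin n)) (i : Fin n) :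
    (monoGL b d w : V →ₗ[K] V) (b i) = (d (w i) : K) • b (w i) := by
  change (b.equiv (b.unitsSMul d) w) (b i) = _
  simp [Module.Basis.unitsSMul_apply, Units.smul_def]

/-- The class of `monoGL b d w` in `PGL(V)`. -/
def mono (d : Fin n → Kˣ) (w : Equiv.Perm (Fin n)) : PGL K V := PGL.mk (monoGL b d w)

lemma gl_ext {g h : LinearMap.GeneralLinearGroup K V}
    (H : ∀ i, (g : V →ₗ[K] V) (b i) = (h : V →ₗ[K] V) (b i)) : g = h :=
  Units.ext (b.ext H)

lemma mono_mul (d d' : Fin n → Kˣ) (w w' : Equiv.Perm (Fin n)) :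
    mono b d w * mono b d' w' = mono b (d * (d' ∘ w.symm)) (w * w') := by
  unfold mono
  rw [← map_mul]
  congr 1
  refine gl_ext b fun i => ?_
  rw [Units.val_mul, Module.End.mul_apply, monoGL_apply, map_smul, monoGL_apply, monoGL_apply,
    smul_smul]
  simp [mul_comm]

lemma mono_one : mono b 1 1 = 1 := by
  unfold mono
  rw [← map_one (PGL.mk : _ →* PGL K V)]
  congr 1
  refine gl_ext b fun i => ?_
  rw [monoGL_apply]
  simp

/-- The torus `T`: the classes of the diagonal matrices with respect to the basis. -/
def torus : Subgroup (PGL K V) where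
  carrier := {g | ∃ d, g = mono b d 1}
  mul_mem' := by
    rintro _ _ ⟨d, rfl⟩ ⟨d', rfl⟩
    exact ⟨_, mono_mul b d d' 1 1⟩
  one_mem' := ⟨1, (mono_one b).symm⟩
  inv_mem' := by
    rintro _ ⟨d, rfl⟩
    refine ⟨d⁻¹, inv_eq_of_mul_eq_one_right ?_⟩
    rw [mono_mul, ← mono_one b]
    congr 1
    funext i
    exact mul_inv_cancel (d i)

/-- The group `N`, the normalizer of `T`. -/
def N : Subgroup (PGL K V) := Subgroup.normalizer (torus b : Set (PGL K V))

/-- Central elements of `GL(V)` are scalar. -/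
lemma exists_scalar_of_mem_center (b : Module.Basis (Fin n) K V)
    {z : LinearMap.GeneralLinearGroup K V}
    (hz : z ∈ Subgroup.center (LinearMap.GeneralLinearGroup K V)) :
    ∃ c : K, (z : V →ₗ[K] V) = c • 1 := by
  rcases subsingleton_or_nontrivial (Fin n) with hs | hs
  · rcases isEmpty_or_nonempty (Fin n) with he | ⟨⟨i⟩⟩
    · exact ⟨0, b.ext fun i => he.elim i⟩
    · refine ⟨b.repr ((z : V →ₗ[K] V) (b i)) i, b.ext fun j => ?_⟩
      obtain rfl := Subsingleton.elim i j
      apply b.repr.injective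
      ext k
      obtain rfl := Subsingleton.elim i k
      simp
  · obtain ⟨a, ha⟩ := LinearMap.commute_transvections_iff_of_basis b
      (f := (z : V →ₗ[K] V)) (fun i j r hij => by
        have h0 : b.coord i (r • b j) = 0 := by simp [hij.symm]
        have := Subgroup.mem_center_iff.1 hz
          (LinearMap.GeneralLinearGroup.ofLinearEquiv (LinearEquiv.transvection h0))
        exact (congrArg Units.val this).symm)
    exact ⟨a, by simpa [Subring.smul_def] using ha⟩

/-- Elements of `GL(V)` with the same class differ by a scalar. -/
lemma exists_scalar_of_mk_eq (b : Module.Basis (Fin n) K V)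
    {g h : LinearMap.GeneralLinearGroup K V}
    (H : PGL.mk g = PGL.mk h) :
    ∃ c : K, (h : V →ₗ[K] V) = c • (g : V →ₗ[K] V) := by
  obtain ⟨z, hz, rfl⟩ := (QuotientGroup.mk'_eq_mk' _).1 H
  obtain ⟨c, hc⟩ := exists_scalar_of_mem_center b hz
  refine ⟨c, ?_⟩
  rw [Units.val_mul, hc]
  ext x
  simp

/-- Monomial representatives are unique up to a common scalar. -/
lemma mono_inj [NeZero n] {d d' : Fin n → Kˣ} {w w' : Equiv.Perm (Fin n)}
    (H : mono b d w = mono b d' w') : w = w' ∧ ∃ c : Kˣ, ∀ i, d' i = c * d i := by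
  obtain ⟨c, hc⟩ := exists_scalar_of_mk_eq b H
  have h1 : ∀ i, (d' (w' i) : K) • b (w' i) = (c * d (w i) : K) • b (w i) := fun i => by
    rw [← monoGL_apply, hc, LinearMap.smul_apply, monoGL_apply, smul_smul]
  have hw : ∀ i, w i = w' i := fun i => by
    by_contra hne
    have := congrArg (fun x => b.repr x (w' i)) (h1 i)
    simp [hne] at this
  have hww : w = w' := Equiv.ext hw
  subst hww
  have h2 : ∀ i, (d' i : K) = c * d i := fun i => by
    have := congrArg (fun x => b.repr x i) (h1 (w.symm i))
    simpa using this
  have hc0 : c ≠ 0 := by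
    rintro rfl
    have := h2 0
    simp at this
  exact ⟨rfl, Units.mk0 c hc0, fun i => Units.ext (by simpa using h2 i)⟩

/-- Monomial matrices normalize the torus. -/
lemma mono_mem_N (d : Fin n → Kˣ) (w : Equiv.Perm (Fin n)) : mono b d w ∈ N b := by
  have key : ∀ e : Fin n → Kˣ,
      mono b d w * mono b e 1 * (mono b d w)⁻¹ = mono b (e ∘ w.symm) 1 := fun e => by
    rw [mul_inv_eq_iff_eq_mul, mono_mul, mono_mul, mul_one, one_mul]
    congr 1
    funext i
    exact mul_comm _ _
  refine Subgroup.mem_normalizer_iff.2 fun h => ⟨?_, ?_⟩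
  · rintro ⟨e, rfl⟩
    exact ⟨_, key e⟩
  · rintro ⟨e, he⟩
    refine ⟨e ∘ w, ?_⟩
    have h1 := key (e ∘ w)
    have h2 : (e ∘ w) ∘ w.symm = e := by
      funext i
      simp
    rw [h2, ← he] at h1
    exact (mul_left_cancel (mul_right_cancel h1)).symm

/-- Every element of `N` is the class of a monomial matrix. -/
lemma exists_mono_of_mem_N [Infinite K] {g : PGL K V} (hg : g ∈ N b) :
    ∃ d w, g = mono b d w := by
  obtain ⟨g, rfl⟩ := QuotientGroup.mk'_surjective _ g
  -- a diagonal matrix with distinct entries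
  have hinf : Infinite Kˣ :=
    unitsEquivNeZero.infinite_iff.2 (Set.finite_singleton (0 : K)).infinite_compl.to_subtype
  obtain ⟨f⟩ : Nonempty (Fin n ↪ Kˣ) := ⟨Fin.valEmbedding.trans (Infinite.natEmbedding Kˣ)⟩
  obtain ⟨e, he⟩ := (Subgroup.mem_normalizer_iff.1 hg (mono b f 1)).1 ⟨f, rfl⟩
  have he' : (PGL.mk (monoGL b e 1 * g) : PGL K V) = PGL.mk (g * monoGL b f 1) := by
    rw [map_mul, map_mul]
    exact (mul_inv_eq_iff_eq_mul.1 he).symm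
  obtain ⟨c, hc⟩ := exists_scalar_of_mk_eq b he'
  -- the matrix of `g`
  let m : Fin n → Fin n → K := fun i k => b.repr ((g : V →ₗ[K] V) (b i)) k
  have hdiag : ∀ x k, b.repr ((monoGL b e 1 : V →ₗ[K] V) x) k = e k * b.repr x k := by
    intro x k
    have : (b.coord k) ∘ₗ (monoGL b e 1 : V →ₗ[K] V) = (e k : K) • b.coord k := by
      refine b.ext fun i => ?_
      rw [LinearMap.comp_apply, monoGL_apply]
      rcases eq_or_ne i k with rfl | h
      · simp
      · simp [h]
    exact LinearMap.congr_fun this x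
  have hm : ∀ i k, (f i : K) * m i k = c * (e k * m i k) := fun i k => by
    have h1 := congrArg (fun x => b.repr x k) (LinearMap.congr_fun hc (b i))
    simp only [Units.val_mul, Module.End.mul_apply, LinearMap.smul_apply, map_smul,
      Finsupp.smul_apply, smul_eq_mul, monoGL_apply, Equiv.Perm.one_apply] at h1
    rw [hdiag] at h1
    exact h1
  have huniq : ∀ i i' k, m i k ≠ 0 → m i' k ≠ 0 → i = i' := by
    intro i i' k h h'
    have h1 : (f i : K) = c * e k := mul_right_cancel₀ h (by rw [hm, mul_assoc])
    have h2 : (f i' : K) = c * e k := mul_right_cancel₀ h' (by rw [hm, mul_assoc])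
    exact f.injective (Units.ext (h1.trans h2.symm))
  have hex : ∀ i, ∃ k, m i k ≠ 0 := by
    intro i
    by_contra! h
    have h0 : (g : V →ₗ[K] V) (b i) = 0 := b.repr.injective (by ext k; simpa using h k)
    have h1 : b i = 0 := by
      have := congrArg ((g⁻¹ : LinearMap.GeneralLinearGroup K V) : V →ₗ[K] V) h0
      rwa [← Module.End.mul_apply, Units.inv_mul, map_zero] at this
    exact b.ne_zero i h1
  choose w hw using hex
  have hwi : Function.Injective w := fun i i' h => huniq i i' (w i) (hw i) (h ▸ hw i')
  let σ : Equiv.Perm (Fin n) := Equiv.ofBijective w (Finite.injective_iff_bijective.1 hwi)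
  have hσ : ∀ i, σ i = w i := fun _ => rfl
  refine ⟨fun k => Units.mk0 (m (σ.symm k) k) (by
    have := hw (σ.symm k)
    rwa [← hσ, Equiv.apply_symm_apply] at this), σ, ?_⟩
  change PGL.mk g = PGL.mk _
  congr 1
  refine gl_ext b fun i => ?_
  rw [monoGL_apply]
  apply b.repr.injective
  ext k
  rw [map_smul, Finsupp.smul_apply, Module.Basis.repr_self, Units.val_mk0,
    Equiv.symm_apply_apply]
  rcases eq_or_ne (σ i) k with h | h
  · subst h
    simp [m]
  · rw [Finsupp.single_eq_of_ne h.symm, smul_zero]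
    by_contra hne
    have hk : m (σ.symm k) k ≠ 0 := by
      have := hw (σ.symm k)
      rwa [← hσ, Equiv.apply_symm_apply] at this
    exact h (by rw [huniq i _ k hne hk, Equiv.apply_symm_apply])

end Monomial

section Action

variable {K : Type*} [Field K] [ValuativeRel K] [TopologicalSpace K]
  [IsNonarchimedeanLocalField K] {V : Type*} [AddCommGroup V] [Module K V] {n : ℕ}

/-- The vector `(-v(d_1), …, -v(d_n))`. -/
def negVal (d : Fin n → Kˣ) : Fin n → ℝ := fun i => -((vInt (d i : K) : ℤ) : ℝ)

/-- The linear map `A_I → A_{w(I)}` sending `η_i` to `η_{w(i)}`. -/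
def permPiece (w : Equiv.Perm (Fin n)) (I : Finset (Fin n)) :
    Apt I →ₗ[ℝ] Apt (I.map w.toEmbedding) :=
  (constOn I).mapQ (constOn (I.map w.toEmbedding)) (LinearMap.funLeft ℝ ℝ w.symm)
    (fun x hx i hi j hj => by
      obtain ⟨i', hi', rfl⟩ := Finset.mem_map.1 hi
      obtain ⟨j', hj', rfl⟩ := Finset.mem_map.1 hj
      simpa [LinearMap.funLeft] using hx i' hi' j' hj')

/-- The action of the product `t w` of a diagonal matrix `t` with entries `d` and a permutation
matrix `w` on the compactified apartment: `A_I` is mapped to `A_{w(I)}` through `η_i ↦ η_{w(i)}`,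
followed by the translation by `∑_{i ∈ w(I)} -v(d_i) η_i`. -/
def monoAct (d : Fin n → Kˣ) (w : Equiv.Perm (Fin n)) (p : ABar n) : ABar n :=
  ABar.incl (p.1.1.map w.toEmbedding) (p.1.2.map)
    (permPiece w p.1.1 p.2 + Apt.mk (p.1.1.map w.toEmbedding) (negVal d))

variable (b : Module.Basis (Fin n) K V)

/-- Every element of `N` is the class of a monomial matrix. -/
lemma exists_mono (g : N b) : ∃ dw : (Fin n → Kˣ) × Equiv.Perm (Fin n),
    (g : PGL K V) = mono b dw.1 dw.2 := by
  have : Infinite K := infinite_localField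
  obtain ⟨d, w, h⟩ := exists_mono_of_mem_N b g.2
  exact ⟨(d, w), h⟩

/-- The action `ν` of `N = T ⋊ W` on the compactified apartment, see `nu_mono`. -/
def nu (g : N b) : ABar n → ABar n :=
  monoAct (exists_mono b g).choose.1 (exists_mono b g).choose.2

/-- The action `ν` does not depend on the monomial representative. -/
lemma nu_mono [NeZero n] (d : Fin n → Kˣ) (w : Equiv.Perm (Fin n)) :
    nu b ⟨mono b d w, mono_mem_N b d w⟩ = monoAct d w := by
  have h := (exists_mono b ⟨mono b d w, mono_mem_N b d w⟩).choose_spec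
  unfold nu
  generalize (exists_mono b ⟨mono b d w, mono_mem_N b d w⟩).choose = dw at h ⊢
  obtain ⟨d', w'⟩ := dw
  obtain ⟨rfl, c, hc⟩ := mono_inj b h
  funext p
  unfold monoAct
  congr 2
  refine (Submodule.Quotient.eq _).2 fun i _ j _ => ?_
  have h1 : ∀ k, ((vInt (d' k : K) : ℤ) : ℝ) = vInt (c : K) + vInt (d k : K) := fun k => by
    have hk : d' k = c * d k := hc k
    rw [hk, Units.val_mul, vInt_mul c.ne_zero (d k).ne_zero, Int.cast_add]
  simp only [Pi.sub_apply, negVal, h1]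
  ring

/-- The subgroup `Z ⊆ T`, the kernel of `ν : T → A`, `t ↦ ∑ -v(d_i) η_i`. -/
def Zset : Set (PGL K V) := {t | ∃ d : Fin n → Kˣ, t = mono b d 1 ∧ A.mk (negVal d) = 0}

/-! ### Root groups and the groups `P_x` -/

/-- The element of the root group `U_{a_{ij}}` with matrix entry `ω` at the place `(i, j)`:
it maps `v_j` to `v_j + ω v_i` and fixes the other basis vectors. -/
def rootElt {i j : Fin n} (h : i ≠ j) (ω : K) : PGL K V :=
  PGL.mk (LinearMap.GeneralLinearGroup.ofLinearEquiv
    (LinearEquiv.transvection (f := b.coord j) (v := ω • b i) (by simp [h])))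

/-- The subgroup `U_{a, l}` of the root group `U_a`, `a = a_{ij}`, for `l ∈ ℝ ∪ {±∞}`:
the elements `u` with `ψ_a(u) ≥ l`. -/
def rootSet {i j : Fin n} (h : i ≠ j) (l : EReal) : Set (PGL K V) :=
  {u | ∃ ω : K, u = rootElt b h ω ∧ l ≤ v ω}

/-- For a function `f` on the roots, the group generated by all `U_{a, f(a)}`. -/
def genU (f : Fin n → Fin n → EReal) : Subgroup (PGL K V) :=
  Subgroup.closure (⋃ (i : Fin n) (j : Fin n) (h : i ≠ j), rootSet b h (f i j))

variable [NeZero n]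

/-- `f_x(a) = inf {t ∈ ℝ : x lies in the closure of {z ∈ A : a(z) ≥ -t}}` for the root
`a = a_{ij}`, an element of `ℝ ∪ {±∞}`. -/
def fRoot (x : ABar n) (i j : Fin n) : EReal :=
  sInf {l : EReal | ∃ t : ℝ, l = (t : EReal) ∧
    x ∈ closure (ABar.ofA '' {z : A n | -t ≤ root i j z})}

/-- `N_x = {n ∈ N : ν(n) x = x}`. -/
def Nstab (x : ABar n) : Set (PGL K V) := {g | ∃ h : g ∈ N b, nu b ⟨g, h⟩ x = x}

/-- `P_x = U_x N_x` for points `x` of the apartment `A`, where `U_x` is generated by the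
`U_{a, -a(x)}`. -/
def PA (x : A n) : Set (PGL K V) :=
  (genU b (fun i j => ((-(root i j x) : ℝ) : EReal)) : Set (PGL K V)) * Nstab b (ABar.ofA x)

/-- `P_x = U_x N_x` for points `x` of the compactified apartment, where `U_x` is generated by the
`U_{a, f_x(a)}`. -/
def PBar (x : ABar n) : Set (PGL K V) :=
  (genU b (fRoot x) : Set (PGL K V)) * Nstab b x

/-- The set underlying the compact open subgroup `U_0^∧ = U_0 Z`, where `0 ∈ A`. -/
def U0hat : Set (PGL K V) :=
  (genU b (fRoot (ABar.ofA (0 : A n))) : Set (PGL K V)) * Zset b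

/-! ### The building and its compactification -/

/-- The relation on `G × A` defining the building (an equivalence relation). -/
def relX (p q : PGL K V × A n) : Prop :=
  ∃ m : N b, nu b m (ABar.ofA p.2) = ABar.ofA q.2 ∧ p.1⁻¹ * q.1 * m ∈ PA b p.2

/-- The Bruhat-Tits building `X = G × A / ~`. -/
def X : Type _ := Quot (relX b)

/-- The quotient topology. -/
instance : TopologicalSpace (X b) := inferInstanceAs (TopologicalSpace (Quot (relX b)))

/-- The class of `(g, x)` in the building. -/
def X.mk (g : PGL K V) (x : A n) : X b := Quot.mk _ (g, x)

/-- The relation on `U_0^∧ × ABar` defining the compactification (an equivalence relation). -/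
def relXBar (p q : U0hat b × ABar n) : Prop :=
  ∃ m : N b, nu b m p.2 = q.2 ∧ (p.1 : PGL K V)⁻¹ * (q.1 : PGL K V) * m ∈ PBar b p.2

/-- The compactified building: the quotient of `U_0^∧ × ABar`. -/
def XBar : Type _ := Quot (relXBar b)

/-- The quotient topology. -/
instance : TopologicalSpace (XBar b) := inferInstanceAs (TopologicalSpace (Quot (relXBar b)))

/-- The class of `(u, x)` in the compactified building. -/
def XBar.mk (u : U0hat b) (x : ABar n) : XBar b := Quot.mk _ (u, x)

end Action

end

end BTCompactification

/-! Points are read as homothety classes of seminorms on `V`. With `absK = exp (-v)`, the point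
`∑_{i ∈ I} x_i η_i` of `A_I` gives the weights `p_i = exp (-x_i)` for `i ∈ I` and `p_i = 0`
otherwise, determined up to a positive factor, and a pair `(g, ξ)` gives the seminorm `y ↦ max_i
|(g⁻¹ y)_i| p_i`. Points of `A` give norms; the boundary pieces give seminorms with a kernel.

The relation defining both quotients is exactly homothety of these seminorms (`normalized_eq_iff`).
In one direction, `N` transports weights, and the generators of `U_x` are the root elements with
`|ω| p_i ≤ p_j`, which are isometries. The converse is Gaussian elimination with pivots chosen by
size (`exists_monomial_columns`): a similitude between two weighted seminorms is a product of such
root elements and a monomial matrix.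

Dividing a seminorm by its maximum on the basis therefore gives an injective continuous map from the
compactification to `V → ℝ`. Its source is compact: `coords` identifies `ABar` with the non-negative
part of the sup-norm unit sphere (`isInducing_coords`), and `U_0^∧` is the image of the integral
matrices with integral inverse (`isCompact_U0hat`). So the map is a closed embedding and the
quotient is Hausdorff.

For the contraction, let `γ₀` be the standard norm. It is invariant under `U_0^∧`, so `max(γ, t γ₀)`
is again a point, in the same translate of `ABar` as `γ`; it moves from `γ` to `γ₀` as `t` runs from
0 to 1.

The building has the same invariant. A Cartan decomposition (`exists_cartan`) moves each of its
points into `U_0^∧ × A`. The image is open and dense because `A` is open and dense in `ABar` and `N`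
preserves `A`. -/

namespace BTCompactification

noncomputable section

/-! ### The absolute value attached to the normalized valuation. -/

section AbsoluteValue

variable {K : Type*} [Field K] [ValuativeRel K] [TopologicalSpace K]
  [IsNonarchimedeanLocalField K]

open Classical in
/-- The absolute value `exp (-v x)` on `K`. -/
def absK (x : K) : ℝ := if x = 0 then 0 else Real.exp (-(vInt x : ℝ))

@[simp] lemma absK_zero : absK (0 : K) = 0 := if_pos rfl

lemma absK_of_ne_zero {x : K} (hx : x ≠ 0) : absK x = Real.exp (-(vInt x : ℝ)) := if_neg hx

lemma absK_pos {x : K} (hx : x ≠ 0) : 0 < absK x := by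
  rw [absK_of_ne_zero hx]; exact Real.exp_pos _

lemma absK_nonneg (x : K) : 0 ≤ absK x := by
  by_cases hx : x = 0
  · simp [hx]
  · exact (absK_pos hx).le

lemma absK_eq_zero {x : K} : absK x = 0 ↔ x = 0 :=
  ⟨fun h => by_contra fun hx => (absK_pos hx).ne' h, fun h => by simp [h]⟩

lemma absK_mul (x y : K) : absK (x * y) = absK x * absK y := by
  by_cases hx : x = 0
  · simp [hx]
  by_cases hy : y = 0
  · simp [hy]
  rw [absK_of_ne_zero hx, absK_of_ne_zero hy, absK_of_ne_zero (mul_ne_zero hx hy),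
    vInt_mul hx hy, ← Real.exp_add]
  congr 1
  push_cast
  ring

@[simp] lemma absK_one : absK (1 : K) = 1 := by
  have h := absK_mul (1 : K) 1
  rw [mul_one] at h
  have h0 : absK (1 : K) ≠ 0 := (absK_pos one_ne_zero).ne'
  exact (mul_eq_left₀ h0).1 h.symm

lemma absK_inv (x : K) : absK x⁻¹ = (absK x)⁻¹ := by
  by_cases hx : x = 0
  · simp [hx]
  · refine eq_inv_of_mul_eq_one_left ?_
    rw [← absK_mul, inv_mul_cancel₀ hx, absK_one]

lemma absK_div (x y : K) : absK (x / y) = absK x / absK y := by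
  rw [div_eq_mul_inv, absK_mul, absK_inv, div_eq_mul_inv]

lemma absK_neg (x : K) : absK (-x) = absK x := by
  have h1 : absK (-1 : K) * absK (-1 : K) = 1 := by rw [← absK_mul]; simp
  have h2 : absK (-1 : K) = 1 := by nlinarith [absK_nonneg (-1 : K)]
  rw [neg_eq_neg_one_mul, absK_mul, h2, one_mul]

/-- On nonzero elements `absK` is `exp ∘ log` of the integer form of the value, hence strictly
increasing in the canonical valuation. Through this the ultrametric inequality, the topology and
compactness are inherited from that valuation. -/
lemma absK_le_iff {x y : K} :
    absK x ≤ absK y ↔ ValuativeRel.valuation K x ≤ ValuativeRel.valuation K y := by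
  by_cases hx : x = 0
  · simp [hx, absK_nonneg]
  by_cases hy : y = 0
  · simp only [hy, absK_zero, map_zero, le_zero_iff, Valuation.zero_iff]
    exact ⟨fun h => absK_eq_zero.1 (le_antisymm h (absK_nonneg x)), fun h => by simp [h]⟩
  have hx' : IsNonarchimedeanLocalField.valueGroupWithZeroIsoInt K
      (ValuativeRel.valuation K x) ≠ 0 := by simpa using hx
  have hy' : IsNonarchimedeanLocalField.valueGroupWithZeroIsoInt K
      (ValuativeRel.valuation K y) ≠ 0 := by simpa using hy
  rw [absK_of_ne_zero hx, absK_of_ne_zero hy, Real.exp_le_exp, neg_le_neg_iff, Int.cast_le,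
    vInt, vInt, neg_le_neg_iff, WithZero.log_le_log hx' hy']
  exact (IsNonarchimedeanLocalField.valueGroupWithZeroIsoInt K).strictMono.le_iff_le

lemma absK_lt_iff {x y : K} :
    absK x < absK y ↔ ValuativeRel.valuation K x < ValuativeRel.valuation K y := by
  rw [← not_le, absK_le_iff, not_le]

lemma absK_add_le (x y : K) : absK (x + y) ≤ max (absK x) (absK y) := by
  rcases le_total (ValuativeRel.valuation K x) (ValuativeRel.valuation K y) with h | h
  · refine le_max_of_le_right (absK_le_iff.2 ?_)
    exact (Valuation.map_add _ x y).trans (max_le h le_rfl)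
  · refine le_max_of_le_left (absK_le_iff.2 ?_)
    exact (Valuation.map_add _ x y).trans (max_le le_rfl h)

/-- The reverse triangle inequality reduces continuity to the point 0. There, an element of absolute
value less than 1 has powers giving arbitrarily small valuation balls, which are neighbourhoods of
0. -/
lemma continuous_absK : Continuous (absK : K → ℝ) := by
  have hsub : ∀ x y : K, |absK x - absK y| ≤ absK (x - y) := fun x y => by
    have h1 := absK_add_le (x - y) y
    have h2 := absK_add_le (y - x) x
    rw [sub_add_cancel] at h1 h2
    have h3 : absK (y - x) = absK (x - y) := by rw [← neg_sub, absK_neg]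
    have := absK_nonneg x
    have := absK_nonneg y
    have := absK_nonneg (x - y)
    rw [abs_le]
    rcases le_max_iff.1 h1 with h | h <;> rcases le_max_iff.1 h2 with h' | h' <;>
      constructor <;> linarith
  have h0 : Filter.Tendsto (absK : K → ℝ) (𝓝 0) (𝓝 0) := by
    obtain ⟨x, hx0, hx1⟩ :=
      Valuation.IsNontrivial.exists_lt_one (v := ValuativeRel.valuation K)
    have hx : x ≠ 0 := hx0
    have hlt : absK x < 1 := by
      rw [← absK_one (K := K), absK_lt_iff, map_one]
      exact hx1
    rw [Metric.tendsto_nhds]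
    intro ε hε
    obtain ⟨m, hm⟩ := exists_pow_lt_of_lt_one hε hlt
    have hpow : ∀ k : ℕ, absK (x ^ k) = absK x ^ k := fun k => by
      induction k with
      | zero => simp
      | succ k ih => rw [pow_succ, absK_mul, ih, pow_succ]
    have hb := (IsValuativeTopology.hasBasis_nhds_zero' K).mem_of_mem
      (i := ValuativeRel.valuation K (x ^ m)) (by simpa using fun h => absurd h hx)
    filter_upwards [hb] with y hy
    rw [Real.dist_eq, sub_zero, abs_of_nonneg (absK_nonneg y)]
    exact (absK_lt_iff.2 hy).trans (by rwa [hpow])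
  refine continuous_iff_continuousAt.2 fun x => ?_
  refine tendsto_iff_dist_tendsto_zero.2 ?_
  refine squeeze_zero (fun _ => dist_nonneg) (fun y => (Real.dist_eq _ _).trans_le (hsub y x)) ?_
  refine h0.comp ?_
  have : Continuous fun y : K => y - x := continuous_id.sub continuous_const
  simpa using this.tendsto x

/-- Compactness of the ring of integers; the compactness of `U_0^∧` rests on it. -/
lemma isCompact_absK_le_one : IsCompact {x : K | absK x ≤ 1} := by
  convert IsNonarchimedeanLocalField.isCompact_closedBall K 1 using 3 with x
  rw [← absK_one (K := K), absK_le_iff, map_one]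

/-- The extended valuation in terms of the absolute value. -/
lemma v_eq_neg_log {ω : K} (hω : ω ≠ 0) : v ω = ((-Real.log (absK ω) : ℝ) : EReal) := by
  rw [v, if_neg hω, absK_of_ne_zero hω, Real.log_exp, neg_neg]

end AbsoluteValue

/-! ### Root elements lifted to `GL(V)`. -/

section RootElements

variable {K : Type*} [Field K] {V : Type*} [AddCommGroup V] [Module K V] {n : ℕ}
  (b : Module.Basis (Fin n) K V)

/-- The linear automorphism `v_j ↦ v_j + ω v_i`. -/
def rootGL {i j : Fin n} (h : i ≠ j) (ω : K) : LinearMap.GeneralLinearGroup K V :=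
  LinearMap.GeneralLinearGroup.ofLinearEquiv
    (LinearEquiv.transvection (f := b.coord j) (v := ω • b i) (by simp [h]))

lemma rootGL_apply {i j : Fin n} (h : i ≠ j) (ω : K) (w : V) :
    (rootGL b h ω).val w = w + b.repr w j • ω • b i := rfl

lemma rootGL_mul_neg {i j : Fin n} (h : i ≠ j) (ω : K) : rootGL b h ω * rootGL b h (-ω) = 1 := by
  refine gl_ext b fun k => ?_
  rw [Units.val_mul, Module.End.mul_apply, rootGL_apply, rootGL_apply]
  simp [Finsupp.single_eq_of_ne h.symm]

lemma val_injective (g : LinearMap.GeneralLinearGroup K V) : Function.Injective g.val := by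
  intro x y h
  have := congrArg (g⁻¹).val h
  rwa [← Module.End.mul_apply, ← Module.End.mul_apply, ← Units.val_mul, inv_mul_cancel] at this

end RootElements

/-! ### Weighted seminorms and elimination by their isometries. -/

section WeightedNorm

variable {K : Type*} [Field K] [ValuativeRel K] [TopologicalSpace K]
  [IsNonarchimedeanLocalField K] {V : Type*} [AddCommGroup V] [Module K V] {n : ℕ}
  (b : Module.Basis (Fin n) K V)

/-- The seminorm `∑ c_i v_i ↦ max |c_i| p_i` on `V` with weights `p`. -/
def wnorm (p : Fin n → ℝ) (w : V) : ℝ := ‖fun i => absK (b.repr w i) * p i‖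

variable {p q : Fin n → ℝ}

lemma wnorm_nonneg (p : Fin n → ℝ) (w : V) : 0 ≤ wnorm b p w := norm_nonneg _

lemma le_wnorm (p : Fin n → ℝ) (w : V) (i : Fin n) :
    absK (b.repr w i) * p i ≤ wnorm b p w :=
  (le_abs_self _).trans (norm_le_pi_norm (fun i => absK (b.repr w i) * p i) i)

lemma wnorm_le_iff (hp : 0 ≤ p) {w : V} {r : ℝ} (hr : 0 ≤ r) :
    wnorm b p w ≤ r ↔ ∀ i, absK (b.repr w i) * p i ≤ r := by
  refine ⟨fun h i => (le_wnorm b p w i).trans h, fun h => ?_⟩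
  refine (pi_norm_le_iff_of_nonneg hr).2 fun i => ?_
  rw [Real.norm_of_nonneg (mul_nonneg (absK_nonneg _) (hp i))]
  exact h i

lemma exists_wnorm_eq [NeZero n] (hp : 0 ≤ p) (w : V) :
    ∃ i, wnorm b p w = absK (b.repr w i) * p i := by
  obtain ⟨i, -, hi⟩ := Finset.exists_max_image Finset.univ
    (fun i => absK (b.repr w i) * p i) Finset.univ_nonempty
  exact ⟨i, le_antisymm ((wnorm_le_iff b hp (mul_nonneg (absK_nonneg _) (hp i))).2
    fun j => hi j (Finset.mem_univ j)) (le_wnorm b p w i)⟩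

lemma wnorm_basis (hp : 0 ≤ p) (i : Fin n) : wnorm b p (b i) = p i := by
  refine le_antisymm ((wnorm_le_iff b hp (hp i)).2 fun j => ?_) ?_
  · rcases eq_or_ne j i with rfl | h
    · simp
    · simpa [Finsupp.single_eq_of_ne h] using hp i
  · simpa using le_wnorm b p (b i) i

lemma wnorm_smul (p : Fin n → ℝ) (c : K) (w : V) :
    wnorm b p (c • w) = absK c * wnorm b p w := by
  have : (fun i => absK (b.repr (c • w) i) * p i) =
      absK c • fun i => absK (b.repr w i) * p i := by
    funext i
    simp [absK_mul, mul_assoc]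
  rw [wnorm, this, norm_smul, Real.norm_of_nonneg (absK_nonneg c), wnorm]

lemma wnorm_smul_weight {c : ℝ} (hc : 0 ≤ c) (p : Fin n → ℝ) (w : V) :
    wnorm b (c • p) w = c * wnorm b p w := by
  have : (fun i => absK (b.repr w i) * (c • p) i) =
      c • fun i => absK (b.repr w i) * p i := by
    funext i
    simp only [Pi.smul_apply, smul_eq_mul]
    ring
  rw [wnorm, this, norm_smul, Real.norm_of_nonneg hc, wnorm]

lemma wnorm_add_le (hp : 0 ≤ p) (w w' : V) :
    wnorm b p (w + w') ≤ max (wnorm b p w) (wnorm b p w') := by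
  refine (wnorm_le_iff b hp (le_max_of_le_left (wnorm_nonneg b p w))).2 fun i => ?_
  rw [map_add, Finsupp.add_apply]
  refine (mul_le_mul_of_nonneg_right (absK_add_le _ _) (hp i)).trans ?_
  rw [max_mul_of_nonneg _ _ (hp i)]
  exact max_le_max (le_wnorm b p w i) (le_wnorm b p w' i)

lemma wnorm_sum_le {ι : Type*} (hp : 0 ≤ p) (s : Finset ι) (f : ι → V) {r : ℝ} (hr : 0 ≤ r)
    (h : ∀ i ∈ s, wnorm b p (f i) ≤ r) : wnorm b p (∑ i ∈ s, f i) ≤ r := by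
  classical
  induction s using Finset.induction_on with
  | empty => simpa [wnorm, pi_norm_le_iff_of_nonneg hr] using fun _ => hr
  | insert a s ha ih =>
    rw [Finset.sum_insert ha]
    exact (wnorm_add_le b hp _ _).trans (max_le (h a (Finset.mem_insert_self a s))
      (ih fun i hi => h i (Finset.mem_insert_of_mem hi)))

/-- A linear map is bounded by its values on the basis. -/
lemma wnorm_map_le (hp : 0 ≤ p) (g : V →ₗ[K] V) (w : V) :
    wnorm b p (g w) ≤ wnorm b 1 w * ‖fun j => wnorm b p (g (b j))‖ := by
  conv_lhs => rw [← b.sum_repr w, map_sum]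
  refine wnorm_sum_le b hp _ _ (mul_nonneg (wnorm_nonneg _ _ _) (norm_nonneg _)) fun j _ => ?_
  rw [map_smul, wnorm_smul]
  refine mul_le_mul ?_ ?_ (wnorm_nonneg _ _ _) (wnorm_nonneg _ _ _)
  · simpa using le_wnorm b 1 w j
  · exact (le_abs_self _).trans (norm_le_pi_norm (fun j => wnorm b p (g (b j))) j)

/-- The subgroup of `GL(V)` generated by the root elements preserving the seminorm with
weights `p`. -/
def rootSubgroup (p : Fin n → ℝ) : Subgroup (LinearMap.GeneralLinearGroup K V) :=
  Subgroup.closure (⋃ (i : Fin n) (j : Fin n) (h : i ≠ j),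
    {u | ∃ ω : K, u = rootGL b h ω ∧ absK ω * p i ≤ p j})

lemma rootGL_mem {i j : Fin n} (h : i ≠ j) {ω : K} (hω : absK ω * p i ≤ p j) :
    rootGL b h ω ∈ rootSubgroup b p :=
  Subgroup.subset_closure (Set.mem_iUnion.2 ⟨i, Set.mem_iUnion.2 ⟨j, Set.mem_iUnion.2
    ⟨h, ω, rfl, hω⟩⟩⟩)

/-- The correction term `w_j ω v_i` has seminorm `|w_j| |ω| p_i ≤ |w_j| p_j`, which is already
counted in the seminorm of `w`. -/
lemma wnorm_rootGL_le (hp : 0 ≤ p) {i j : Fin n} (h : i ≠ j) {ω : K} (hω : absK ω * p i ≤ p j)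
    (w : V) : wnorm b p ((rootGL b h ω).val w) ≤ wnorm b p w := by
  rw [rootGL_apply]
  refine (wnorm_add_le b hp _ _).trans (max_le le_rfl ?_)
  rw [wnorm_smul, wnorm_smul, wnorm_basis b hp]
  exact (mul_le_mul_of_nonneg_left hω (absK_nonneg _)).trans (le_wnorm b p w j)

lemma wnorm_rootSubgroup (hp : 0 ≤ p) {u : LinearMap.GeneralLinearGroup K V}
    (hu : u ∈ rootSubgroup b p) : ∀ w, wnorm b p (u.val w) = wnorm b p w := by
  induction hu using Subgroup.closure_induction with
  | mem u hu =>
    simp only [Set.mem_iUnion] at hu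
    obtain ⟨i, j, h, ω, rfl, hω⟩ := hu
    intro w
    refine le_antisymm (wnorm_rootGL_le b hp h hω w) ?_
    -- The inverse has parameter `-ω` and satisfies the same bound, so the inequality for it gives
    -- the reverse estimate.
    have hω' : absK (-ω) * p i ≤ p j := by rwa [absK_neg]
    have h1 := rootGL_mul_neg b h (-ω)
    rw [neg_neg] at h1
    have h2 := wnorm_rootGL_le b hp h hω' ((rootGL b h ω).val w)
    rwa [← Module.End.mul_apply, ← Units.val_mul, h1] at h2
  | one => intro w; rfl
  | mul x y _ _ hx hy => intro w; rw [Units.val_mul, Module.End.mul_apply, hx, hy]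
  | inv x _ hx =>
    intro w
    rw [← hx, ← Module.End.mul_apply, ← Units.val_mul, mul_inv_cancel]
    rfl

/-- Adding multiples of the `i`-th coordinate to the other coordinates. -/
lemma exists_clear_column (i : Fin n) (ω : Fin n → K) (S : Finset (Fin n)) (hiS : i ∉ S)
    (hω : ∀ k ∈ S, absK (ω k) * p k ≤ p i) :
    ∃ u ∈ rootSubgroup b p, ∀ w, u.val w = w + b.repr w i • ∑ k ∈ S, ω k • b k := by
  classical
  induction S using Finset.induction_on with
  | empty => exact ⟨1, one_mem _, fun w => by simp⟩
  | insert a S ha ih =>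
    obtain ⟨u, hu, huw⟩ := ih (fun h => hiS (Finset.mem_insert_of_mem h))
      (fun k hk => hω k (Finset.mem_insert_of_mem hk))
    have hai : a ≠ i := by rintro rfl; exact hiS (Finset.mem_insert_self _ _)
    refine ⟨rootGL b hai (ω a) * u,
      mul_mem (rootGL_mem b hai (hω a (Finset.mem_insert_self _ _))) hu, fun w => ?_⟩
    -- Since `i ∉ S`, the operations made so far leave the `i`-th coordinate unchanged, so the next
    -- root element adds a multiple of the original one.
    have hz : b.repr (∑ k ∈ S, ω k • b k) i = 0 := by
      rw [map_sum, Finsupp.finsetSum_apply]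
      refine Finset.sum_eq_zero fun k hk => ?_
      have : i ≠ k := by rintro rfl; exact hiS (Finset.mem_insert_of_mem hk)
      simp [Finsupp.single_eq_of_ne this]
    rw [Units.val_mul, Module.End.mul_apply, rootGL_apply, huw, Finset.sum_insert ha, map_add,
      map_smul, Finsupp.add_apply, Finsupp.smul_apply, hz, smul_zero, add_zero, smul_add]
    abel

/-- Adding multiples of the other coordinates to the `j`-th coordinate. -/
lemma exists_clear_row (j : Fin n) (ω : Fin n → K) (S : Finset (Fin n)) (hjS : j ∉ S)
    (hω : ∀ k ∈ S, absK (ω k) * p j ≤ p k) :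
    ∃ u ∈ rootSubgroup b p, ∀ w, u.val w = w + (∑ k ∈ S, b.repr w k * ω k) • b j := by
  classical
  induction S using Finset.induction_on with
  | empty => exact ⟨1, one_mem _, fun w => by simp⟩
  | insert a S ha ih =>
    obtain ⟨u, hu, huw⟩ := ih (fun h => hjS (Finset.mem_insert_of_mem h))
      (fun k hk => hω k (Finset.mem_insert_of_mem hk))
    have hja : j ≠ a := by rintro rfl; exact hjS (Finset.mem_insert_self _ _)
    refine ⟨rootGL b hja (ω a) * u,
      mul_mem (rootGL_mem b hja (hω a (Finset.mem_insert_self _ _))) hu, fun w => ?_⟩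
    rw [Units.val_mul, Module.End.mul_apply, rootGL_apply, huw, Finset.sum_insert ha, map_add,
      map_smul, Finsupp.add_apply, Finsupp.smul_apply, b.repr_self,
      Finsupp.single_eq_of_ne hja.symm, smul_zero, add_zero, add_smul, smul_smul]
    abel

/-- If `g` maps two seminorms with weights to each other, then the columns of `g` can successively
be made monomial through row operations preserving the target seminorm. -/
lemma exists_monomial_columns [NeZero n] (hp : 0 ≤ p) (hq : 0 ≤ q)
    (g : LinearMap.GeneralLinearGroup K V) {c : ℝ} (hc : 0 < c)
    (hg : ∀ w, wnorm b p (g.val w) = c * wnorm b q w) (S : Finset (Fin n)) :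
    ∃ u ∈ rootSubgroup b p, ∃ (σ : Fin n → Fin n) (d : Fin n → K),
      ∀ j ∈ S, d j ≠ 0 ∧ (u * g).val (b j) = d j • b (σ j) := by
  classical
  induction S using Finset.induction_on with
  | empty => exact ⟨1, one_mem _, id, 1, by simp⟩
  | insert j₀ S hj₀ ih =>
    obtain ⟨u, hu, σ, d, hd⟩ := ih
    set g' := u * g with hg'
    have hiso : ∀ w, wnorm b p (g'.val w) = c * wnorm b q w := fun w => by
      rw [hg', Units.val_mul, Module.End.mul_apply, wnorm_rootSubgroup b hp hu, hg]
    let a : Fin n → K := fun k => b.repr (g'.val (b j₀)) k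
    have hσ : ∀ s ∈ S, ∀ t ∈ S, σ s = σ t → s = t := by
      intro s hs t ht hst
      by_contra hne
      have h1 : g'.val (d t • b s) = g'.val (d s • b t) := by
        rw [map_smul, map_smul, (hd s hs).2, (hd t ht).2, hst, smul_smul, smul_smul, mul_comm]
      have h2 := congrArg (fun x => b.repr x t) (val_injective g' h1)
      simp only [map_smul, Finsupp.smul_apply, b.repr_self, Finsupp.single_eq_same,
        Finsupp.single_eq_of_ne (Ne.symm hne), smul_eq_mul, mul_zero, mul_one] at h2
      exact (hd s hs).1 h2.symm
    -- Subtracting the columns already treated kills the coordinates `σ s` of the image and leaves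
    -- the others equal to those of column `j₀`, while the `j₀`-coordinate of `w` stays 1.
    let w : V := b j₀ - ∑ s ∈ S, (a (σ s) / d s) • b s
    have hw : b.repr w j₀ = 1 := by
      have h0 : b.repr (∑ s ∈ S, (a (σ s) / d s) • b s) j₀ = 0 := by
        rw [map_sum, Finsupp.finsetSum_apply]
        refine Finset.sum_eq_zero fun s hs => ?_
        have : j₀ ≠ s := by rintro rfl; exact hj₀ hs
        simp [Finsupp.single_eq_of_ne this]
      simp only [w]
      rw [map_sub, Finsupp.sub_apply, h0]
      simp
    have hgw : ∀ k, b.repr (g'.val w) k =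
        a k - ∑ s ∈ S, a (σ s) * (Finsupp.single (σ s) (1 : K)) k := by
      intro k
      simp only [w]
      rw [map_sub, map_sub, Finsupp.sub_apply, map_sum, map_sum, Finsupp.finsetSum_apply]
      congr 1
      refine Finset.sum_congr rfl fun s hs => ?_
      rw [map_smul, (hd s hs).2, smul_smul, div_mul_cancel₀ _ (hd s hs).1, map_smul, b.repr_self,
        Finsupp.smul_apply, smul_eq_mul]
    have hgw0 : ∀ s ∈ S, b.repr (g'.val w) (σ s) = 0 := by
      intro s hs
      rw [hgw, Finset.sum_eq_single s]
      · simp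
      · intro t ht hts
        rw [Finsupp.single_eq_of_ne (fun h => hts (hσ t ht s hs h.symm)), mul_zero]
      · exact fun h => absurd hs h
    have hgw1 : ∀ k, (∀ s ∈ S, σ s ≠ k) → b.repr (g'.val w) k = a k := by
      intro k hk
      rw [hgw, Finset.sum_eq_zero, sub_zero]
      intro s hs
      rw [Finsupp.single_eq_of_ne (hk s hs).symm, mul_zero]
    -- The pivot: a row not yet used in which column `j₀` attains its maximal weighted size.
    -- Maximality is what makes the elimination below admissible for the weights `p`.
    obtain ⟨k, hk, hak, hmax⟩ : ∃ k, (∀ s ∈ S, σ s ≠ k) ∧ a k ≠ 0 ∧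
        ∀ l, absK (a l) * p l ≤ absK (a k) * p k := by
      have hle : ∀ l, absK (a l) * p l ≤ c * q j₀ := fun l => by
        rw [← wnorm_basis b hq, ← hiso]
        exact le_wnorm b p _ l
      have hne : ∀ k, b.repr (g'.val w) k ≠ 0 → ∀ s ∈ S, σ s ≠ k := by
        rintro k hk s hs rfl
        exact hk (hgw0 s hs)
      -- If `q j₀ = 0`, all weighted entries of the column vanish and any nonzero coordinate of `g'
      -- w` serves. Otherwise a coordinate realizing the seminorm of `g' w` serves: its size is `c`
      -- times the `q`-seminorm of `w`, at least `c * q j₀`, which bounds every entry.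
      rcases (hq j₀).eq_or_lt with h0 | h0
      · have hw0 : g'.val w ≠ 0 := fun h => by
          have : w = 0 := val_injective g' (by rw [h, map_zero])
          rw [this] at hw
          simp at hw
        obtain ⟨k, hk⟩ : ∃ k, b.repr (g'.val w) k ≠ 0 := by
          by_contra! h
          exact hw0 (b.repr.injective (by ext k; simpa using h k))
        refine ⟨k, hne k hk, by rwa [← hgw1 k (hne k hk)], fun l => (hle l).trans ?_⟩
        rw [← h0]
        simpa using mul_nonneg (absK_nonneg _) (hp k)
      · obtain ⟨k, hk⟩ := exists_wnorm_eq b hp (g'.val w)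
        have h1 : c * q j₀ ≤ absK (b.repr (g'.val w) k) * p k := by
          rw [← hk, hiso]
          refine mul_le_mul_of_nonneg_left ?_ hc.le
          simpa [hw] using le_wnorm b q w j₀
        have h2 : b.repr (g'.val w) k ≠ 0 := fun h => by
          rw [h, absK_zero, zero_mul] at h1
          exact absurd h1 (not_le.2 (mul_pos hc h0))
        have h3 := hne k h2
        rw [hgw1 k h3] at h1 h2
        exact ⟨k, h3, h2, fun l => (hle l).trans h1⟩
    obtain ⟨u', hu', hu'w⟩ := exists_clear_column b k (fun l => -(a l / a k))
      (Finset.univ.erase k) (Finset.notMem_erase _ _) (p := p) (fun l _ => by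
        rw [absK_neg, absK_div, div_mul_eq_mul_div,
          div_le_iff₀ (absK_pos hak), mul_comm (p k)]
        exact hmax l)
    have hcol : u'.val (g'.val (b j₀)) = a k • b k := by
      rw [hu'w]
      change g'.val (b j₀) + a k • _ = _
      rw [Finset.smul_sum]
      have h1 : ∀ l ∈ Finset.univ.erase k, a k • -(a l / a k) • b l = -(a l • b l) := by
        intro l _
        rw [smul_smul, mul_neg, mul_div_cancel₀ _ hak, neg_smul]
      rw [Finset.sum_congr rfl h1, Finset.sum_neg_distrib]
      have h2 : g'.val (b j₀) = a k • b k + ∑ l ∈ Finset.univ.erase k, a l • b l := by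
        rw [Finset.add_sum_erase _ (fun l => a l • b l) (Finset.mem_univ k)]
        exact (b.sum_repr _).symm
      rw [h2]
      abel
    refine ⟨u' * u, mul_mem hu' hu, Function.update σ j₀ k, Function.update d j₀ (a k), ?_⟩
    intro j hj
    rw [mul_assoc, ← hg', Units.val_mul, Module.End.mul_apply]
    rcases eq_or_ne j j₀ with rfl | hne
    · simpa using ⟨hak, hcol⟩
    -- Earlier columns survive: the new operation reads only the coordinate `k`, which vanishes on
    -- them.
    · have hjS := Finset.mem_of_mem_insert_of_ne hj hne
      rw [Function.update_of_ne hne, Function.update_of_ne hne]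
      refine ⟨(hd j hjS).1, ?_⟩
      rw [(hd j hjS).2, hu'w, map_smul, b.repr_self, Finsupp.smul_apply,
        Finsupp.single_eq_of_ne (hk j hjS).symm]
      simp

end WeightedNorm

/-! ### Recognizing and multiplying monomial matrices. -/

section MonomialReduction

variable {K : Type*} [Field K] {V : Type*} [AddCommGroup V] [Module K V] {n : ℕ}
  (b : Module.Basis (Fin n) K V)

/-- Invertibility forces `σ` to be a permutation: if `σ s = σ t`, then `d_t v_s` and `d_s v_t` have
the same image. -/
lemma exists_eq_monoGL (g : LinearMap.GeneralLinearGroup K V) (σ : Fin n → Fin n) (d : Fin n → K)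
    (h : ∀ j, d j ≠ 0 ∧ g.val (b j) = d j • b (σ j)) : ∃ e w, g = monoGL b e w := by
  have hσ : Function.Injective σ := by
    intro s t hst
    by_contra hne
    have h1 : g.val (d t • b s) = g.val (d s • b t) := by
      rw [map_smul, map_smul, (h s).2, (h t).2, hst, smul_smul, smul_smul, mul_comm]
    have h2 := congrArg (fun x => b.repr x t) (val_injective g h1)
    simp only [map_smul, Finsupp.smul_apply, b.repr_self, Finsupp.single_eq_same,
      Finsupp.single_eq_of_ne (Ne.symm hne), smul_eq_mul, mul_zero, mul_one] at h2
    exact (h s).1 h2.symm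
  let w : Equiv.Perm (Fin n) := Equiv.ofBijective σ (Finite.injective_iff_bijective.1 hσ)
  refine ⟨fun k => Units.mk0 (d (w.symm k)) (h _).1, w, gl_ext b fun i => ?_⟩
  rw [monoGL_apply, Units.val_mk0, Equiv.symm_apply_apply]
  exact (h i).2

lemma repr_monoGL (d : Fin n → Kˣ) (w : Equiv.Perm (Fin n)) (x : V) (k : Fin n) :
    b.repr ((monoGL b d w).val x) k = d k * b.repr x (w.symm k) := by
  have : (b.coord k) ∘ₗ (monoGL b d w).val = (d k : K) • b.coord (w.symm k) := by
    refine b.ext fun i => ?_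
    rw [LinearMap.comp_apply, monoGL_apply]
    rcases eq_or_ne (w i) k with rfl | h
    · simp
    · have h' : w.symm k ≠ i := by rintro rfl; exact h (w.apply_symm_apply k)
      simp [Finsupp.single_eq_of_ne h', Finsupp.single_eq_of_ne h.symm]
  exact LinearMap.congr_fun this x

lemma monoGL_mul (d d' : Fin n → Kˣ) (w w' : Equiv.Perm (Fin n)) :
    monoGL b d w * monoGL b d' w' = monoGL b (d * (d' ∘ w.symm)) (w * w') := by
  refine gl_ext b fun i => ?_
  rw [Units.val_mul, Module.End.mul_apply, monoGL_apply, map_smul, monoGL_apply, monoGL_apply,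
    smul_smul]
  simp [mul_comm]

end MonomialReduction

/-! ### Decompositions of `GL(V)` into root elements and monomial matrices. -/

section Reduction

variable {K : Type*} [Field K] [ValuativeRel K] [TopologicalSpace K]
  [IsNonarchimedeanLocalField K] {V : Type*} [AddCommGroup V] [Module K V] {n : ℕ}
  (b : Module.Basis (Fin n) K V) {p q : Fin n → ℝ}

/-- The weights transported by a monomial matrix. -/
def monoWeight (d : Fin n → Kˣ) (w : Equiv.Perm (Fin n)) (p : Fin n → ℝ) : Fin n → ℝ :=
  fun k => (absK (d k : K))⁻¹ * p (w.symm k)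

lemma monoWeight_nonneg (d : Fin n → Kˣ) (w : Equiv.Perm (Fin n)) (hp : 0 ≤ p) :
    0 ≤ monoWeight d w p :=
  fun _ => mul_nonneg (inv_nonneg.2 (absK_nonneg _)) (hp _)

/-- The `k`-th coordinate of the image is `d_k` times the coordinate `w⁻¹ k` of `x`, and the factor
`|d_k|⁻¹` in the transported weight cancels `|d_k|`. -/
lemma wnorm_monoGL (hp : 0 ≤ p) (d : Fin n → Kˣ) (w : Equiv.Perm (Fin n)) (x : V) :
    wnorm b (monoWeight d w p) ((monoGL b d w).val x) = wnorm b p x := by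
  have key : ∀ k, absK (b.repr ((monoGL b d w).val x) k) * monoWeight d w p k =
      absK (b.repr x (w.symm k)) * p (w.symm k) := fun k => by
    rw [repr_monoGL, absK_mul, monoWeight]
    have := (absK_pos (d k).ne_zero).ne'
    field_simp
  refine le_antisymm ((wnorm_le_iff b (monoWeight_nonneg d w hp) (wnorm_nonneg _ _ _)).2
    fun k => ?_) ((wnorm_le_iff b hp (wnorm_nonneg _ _ _)).2 fun k => ?_)
  · rw [key]
    exact le_wnorm b p x _
  · have := key (w k)
    rw [Equiv.symm_apply_apply] at this
    rw [← this]
    exact le_wnorm b _ _ _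

/-- Two seminorms with weights which are conjugate under `g` are conjugate under a monomial
matrix, and `g` is monomial up to root elements. -/
lemma exists_eq_mul_monoGL [NeZero n] (hp : 0 ≤ p) (hq : 0 ≤ q)
    (g : LinearMap.GeneralLinearGroup K V) {c : ℝ} (hc : 0 < c)
    (hg : ∀ w, wnorm b p (g.val w) = c * wnorm b q w) :
    ∃ u ∈ rootSubgroup b p, ∃ d w, g = u * monoGL b d w ∧ c • monoWeight d w q = p := by
  obtain ⟨u, hu, σ, e, he⟩ := exists_monomial_columns b hp hq g hc hg Finset.univ
  obtain ⟨d, w, h⟩ := exists_eq_monoGL b (u * g) σ e fun j => he j (Finset.mem_univ j)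
  refine ⟨u⁻¹, inv_mem hu, d, w, by rw [← h, inv_mul_cancel_left], funext fun k => ?_⟩
  -- Weights are the values of the seminorm on basis vectors, so evaluating at the vector sent to a
  -- multiple of `v_k` yields the `k`-th weight.
  have h1 := hg (b (w.symm k))
  rw [← wnorm_rootSubgroup b hp hu, ← Module.End.mul_apply, ← Units.val_mul, h, monoGL_apply,
    wnorm_smul, wnorm_basis b hp, wnorm_basis b hq, Equiv.apply_symm_apply] at h1
  have := (absK_pos (d k).ne_zero).ne'
  rw [Pi.smul_apply, smul_eq_mul, monoWeight]
  field_simp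
  linarith

/-- Simultaneous row and column reduction. -/
lemma exists_partial_cartan [NeZero n] (hp : ∀ i, 0 < p i)
    (g : LinearMap.GeneralLinearGroup K V) (m : ℕ) (hm : m ≤ n) :
    ∃ u ∈ rootSubgroup b (1 : Fin n → ℝ), ∃ u' ∈ rootSubgroup b p,
      ∃ (S : Finset (Fin n)) (σ : Fin n → Fin n) (d : Fin n → K), S.card = m ∧
      ∀ j ∈ S, d j ≠ 0 ∧ (u * g * u').val (b j) = d j • b (σ j) ∧
        ∀ l, l ≠ j → b.repr ((u * g * u').val (b l)) (σ j) = 0 := by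
  classical
  induction m with
  | zero => exact ⟨1, one_mem _, 1, one_mem _, ∅, id, 1, rfl, by simp⟩
  | succ m ih =>
    obtain ⟨u, hu, u', hu', S, σ, d, hS, hd⟩ := ih (by omega)
    set g' := u * g * u' with hg'
    let a : Fin n → Fin n → K := fun k j => b.repr (g'.val (b j)) k
    have haS : ∀ s ∈ S, ∀ j, j ≠ s → a (σ s) j = 0 := fun s hs j hj => (hd s hs).2.2 j hj
    have hcolS : ∀ s ∈ S, ∀ k, k ≠ σ s → a k s = 0 := fun s hs k hk => by
      change b.repr (g'.val (b s)) k = 0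
      rw [(hd s hs).2.1]
      simp [Finsupp.single_eq_of_ne hk]
    obtain ⟨j₀, hj₀⟩ : ∃ j₀, j₀ ∉ S := by
      by_contra! h
      have := Finset.card_eq_iff_eq_univ S |>.2 (Finset.eq_univ_iff_forall.2 h)
      simp at this
      omega
    -- Maximizing `|a_kj| / p_j` over the untreated columns serves both sides: within column `j` it
    -- gives `|a_lj| ≤ |a_kj|`, so the row operations are integral; within row `k` it gives `|a_kl|
    -- p_j ≤ |a_kj| p_l`, so the column operations preserve the norm with weights `p`.
    obtain ⟨⟨k, j⟩, hkj, hmax⟩ := Finset.exists_max_image (Finset.univ ×ˢ Sᶜ)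
      (fun x => absK (a x.1 x.2) / p x.2) ⟨(0, j₀), by simp [hj₀]⟩
    have hj : j ∉ S := by simpa using hkj
    have hmax' : ∀ k' j', j' ∉ S → absK (a k' j') / p j' ≤ absK (a k j) / p j :=
      fun k' j' h => hmax (k', j') (by simp [h])
    have hak : a k j ≠ 0 := by
      intro h0
      have hz : ∀ k', a k' j₀ = 0 := fun k' => by
        have := hmax' k' j₀ hj₀
        rw [h0, absK_zero, zero_div, div_le_iff₀ (hp j₀), zero_mul] at this
        exact absK_eq_zero.1 (le_antisymm this (absK_nonneg _))
      have : g'.val (b j₀) = g'.val 0 := by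
        rw [map_zero]
        exact b.repr.injective (by ext k'; simpa using hz k')
      exact b.ne_zero j₀ (val_injective g' this)
    have hkS : ∀ s ∈ S, k ≠ σ s := by
      rintro s hs rfl
      exact hak (haS s hs j (by rintro rfl; exact hj hs))
    obtain ⟨r, hr, hrw⟩ := exists_clear_column b k (fun l => -(a l j / a k j))
      (Finset.univ.erase k) (Finset.notMem_erase _ _) (p := 1) (fun l _ => by
        rw [absK_neg, absK_div, Pi.one_apply, Pi.one_apply, mul_one,
          div_le_one (absK_pos hak)]
        have := hmax' l j hj
        rwa [div_le_div_iff_of_pos_right (hp j)] at this)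
    obtain ⟨c, hc, hcw⟩ := exists_clear_row b j (fun l => -(a k l / a k j))
      (Finset.univ.erase j) (Finset.notMem_erase _ _) (p := p) (fun l _ => by
        rw [absK_neg, absK_div, div_mul_eq_mul_div, div_le_iff₀ (absK_pos hak)]
        -- Maximality says nothing about treated columns, but their entry in row `k` is zero.
        by_cases hl : l ∈ S
        · have : a k l = 0 := hcolS l hl k (hkS l hl)
          rw [this, absK_zero, zero_mul]
          exact mul_nonneg (hp l).le (absK_nonneg _)
        · have := hmax' k l hl
          rw [div_le_div_iff₀ (hp l) (hp j)] at this
          linarith)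
    -- the columns after the row operations
    have hrow : ∀ l k', b.repr (r.val (g'.val (b l))) k' =
        if k' = k then a k l else a k' l - a k l * (a k' j / a k j) := by
      intro l k'
      rw [hrw, map_add, Finsupp.add_apply, map_smul, Finsupp.smul_apply, map_sum,
        Finsupp.finsetSum_apply]
      have h1 : ∀ t ∈ Finset.univ.erase k, b.repr (-(a t j / a k j) • b t) k' =
          if k' = t then -(a t j / a k j) else 0 := by
        intro t _
        rcases eq_or_ne k' t with rfl | h
        · simp
        · simp [h, Finsupp.single_eq_of_ne h]
      rw [Finset.sum_congr rfl h1, Finset.sum_ite_eq]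
      by_cases h : k' = k
      · subst h
        simp [a]
      · simp only [Finset.mem_erase, ne_eq, h, not_false_eq_true, Finset.mem_univ, and_self,
          if_true, if_false, smul_eq_mul, a]
        ring
    have hcolj : r.val (g'.val (b j)) = a k j • b k := by
      refine b.repr.injective (Finsupp.ext fun k' => ?_)
      rw [hrow, map_smul, Finsupp.smul_apply, b.repr_self]
      by_cases h : k' = k
      · subst h; simp
      · rw [if_neg h, Finsupp.single_eq_of_ne h, mul_div_cancel₀ _ hak]
        simp
    have hcb : ∀ l, l ≠ j → c.val (b l) = b l - (a k l / a k j) • b j := by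
      intro l hl
      rw [hcw, Finset.sum_eq_single l]
      · simp [sub_eq_add_neg]
      · intro t _ ht
        simp [Finsupp.single_eq_of_ne ht]
      · intro h
        simp [hl] at h
    have hcj : c.val (b j) = b j := by
      rw [hcw, Finset.sum_eq_zero]
      · simp
      · intro t ht
        simp [Finsupp.single_eq_of_ne (Finset.ne_of_mem_erase ht)]
    have hfin : ∀ l, l ≠ j → (r * u * g * (u' * c)).val (b l) =
        r.val (g'.val (b l)) - a k l • b k := by
      intro l hl
      have : r * u * g * (u' * c) = r * g' * c := by rw [hg']; group
      rw [this, Units.val_mul, Units.val_mul, Module.End.mul_apply, Module.End.mul_apply,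
        hcb l hl, map_sub, map_sub, map_smul, map_smul, hcolj, smul_smul,
        div_mul_cancel₀ _ hak]
    have hfinj : (r * u * g * (u' * c)).val (b j) = a k j • b k := by
      have : r * u * g * (u' * c) = r * g' * c := by rw [hg']; group
      rw [this, Units.val_mul, Units.val_mul, Module.End.mul_apply, Module.End.mul_apply, hcj,
        hcolj]
    refine ⟨r * u, mul_mem hr hu, u' * c, mul_mem hu' hc, insert j S, Function.update σ j k,
      Function.update d j (a k j), by rw [Finset.card_insert_of_notMem hj, hS], ?_⟩
    intro s hs
    rcases eq_or_ne s j with rfl | hsj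
    · simp only [Function.update_self]
      refine ⟨hak, hfinj, fun l hl => ?_⟩
      rw [hfin l hl, map_sub, Finsupp.sub_apply, hrow, if_pos rfl]
      simp
    · have hsS := Finset.mem_of_mem_insert_of_ne hs hsj
      rw [Function.update_of_ne hsj, Function.update_of_ne hsj]
      have haks : a k s = 0 := hcolS s hsS k (hkS s hsS)
      refine ⟨(hd s hsS).1, ?_, fun l hl => ?_⟩
      · rw [hfin s hsj, haks, zero_smul, sub_zero, hrw]
        have : b.repr (g'.val (b s)) k = 0 := haks
        rw [this, zero_smul, add_zero]
        exact (hd s hsS).2.1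
      · rcases eq_or_ne l j with rfl | hlj
        · rw [hfinj]
          simp [Finsupp.single_eq_of_ne (hkS s hsS).symm]
        · rw [hfin l hlj, map_sub, Finsupp.sub_apply, hrow, if_neg (hkS s hsS).symm,
            haS s hsS l hl, haS s hsS j (Ne.symm hsj)]
          simp [Finsupp.single_eq_of_ne (hkS s hsS).symm]

/-- A Cartan type decomposition with respect to the standard norm and a norm with weights. -/
lemma exists_cartan [NeZero n] (hp : ∀ i, 0 < p i) (g : LinearMap.GeneralLinearGroup K V) :
    ∃ u ∈ rootSubgroup b (1 : Fin n → ℝ), ∃ u' ∈ rootSubgroup b p, ∃ d w,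
      g = u * monoGL b d w * u' := by
  obtain ⟨u, hu, u', hu', S, σ, d, hS, hd⟩ := exists_partial_cartan b hp g n le_rfl
  have hS' : S = Finset.univ := (Finset.card_eq_iff_eq_univ S).1 (by simpa using hS)
  obtain ⟨e, w, h⟩ := exists_eq_monoGL b (u * g * u') σ d fun j => by
    have := hd j (by simp [hS'])
    exact ⟨this.1, this.2.1⟩
  refine ⟨u⁻¹, inv_mem hu, u'⁻¹, inv_mem hu', e, w, ?_⟩
  rw [← h]
  group

/-- A permutation matrix is, up to a diagonal matrix of signs, a product of integral root
elements. -/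
lemma exists_signed_perm (w : Equiv.Perm (Fin n)) :
    ∃ d : Fin n → Kˣ, (∀ i, absK (d i : K) = 1) ∧
      monoGL b d w ∈ rootSubgroup b (1 : Fin n → ℝ) := by
  classical
  induction w using Equiv.Perm.swap_induction_on with
  | one =>
    refine ⟨1, by simp, ?_⟩
    have : monoGL b 1 1 = 1 := gl_ext b fun i => by rw [monoGL_apply]; simp
    rw [this]
    exact one_mem _
  | swap_mul w i j hij ih =>
    obtain ⟨d, hd, hmem⟩ := ih
    let e : Fin n → Kˣ := Function.update 1 j (-1)
    have he : ∀ k, absK (e k : K) = 1 := fun k => by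
      rcases eq_or_ne k j with rfl | h
      · simp [e, absK_neg]
      · simp [e, Function.update_of_ne h]
    -- The `SL₂` identity: three elementary matrices with entries `-1, 1, -1` give the transposition
    -- up to the sign `v_i ↦ -v_j`, `v_j ↦ v_i`.
    have hs : monoGL b e (Equiv.swap i j) =
        rootGL b hij.symm (-1 : K) * rootGL b hij 1 * rootGL b hij.symm (-1) := by
      refine gl_ext b fun k => ?_
      rw [monoGL_apply, Units.val_mul, Units.val_mul, Module.End.mul_apply, Module.End.mul_apply,
        rootGL_apply, rootGL_apply, rootGL_apply]
      rcases eq_or_ne k i with rfl | hki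
      · simp [e, Finsupp.single_eq_of_ne hij, Finsupp.single_eq_of_ne hij.symm]
      rcases eq_or_ne k j with rfl | hkj
      · simp [e, Finsupp.single_eq_of_ne hij, Function.update_of_ne hij]
      · simp [e, Equiv.swap_apply_of_ne_of_ne hki hkj, Function.update_of_ne hkj,
          Finsupp.single_eq_of_ne hki.symm, Finsupp.single_eq_of_ne hkj.symm]
    refine ⟨e * (d ∘ (Equiv.swap i j).symm), fun k => ?_, ?_⟩
    · rw [Pi.mul_apply, Units.val_mul, absK_mul, he, Function.comp_apply, hd, mul_one]
    · rw [← monoGL_mul, hs]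
      refine mul_mem (mul_mem (mul_mem ?_ ?_) ?_) hmem <;>
        exact rootGL_mem b _ (by simp [absK_neg])

/-- Monomial matrices with unit entries are integral root elements up to unit diagonal
matrices. -/
lemma exists_monoGL_eq_mul_diag (d : Fin n → Kˣ) (w : Equiv.Perm (Fin n))
    (hd : ∀ i, absK (d i : K) = 1) :
    ∃ u ∈ rootSubgroup b (1 : Fin n → ℝ), ∃ e : Fin n → Kˣ, (∀ i, absK (e i : K) = 1) ∧
      monoGL b d w = u * monoGL b e 1 := by
  obtain ⟨d', hd', hmem⟩ := exists_signed_perm (K := K) b w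
  -- The diagonal factor stands to the right of the permutation, so its entries are those of `d'⁻¹
  -- d` relabelled by `w`.
  refine ⟨_, hmem, (d'⁻¹ * d) ∘ w, fun i => ?_, ?_⟩
  · simp [absK_mul, absK_inv, hd, hd']
  · rw [monoGL_mul, mul_one]
    congr 1
    funext i
    simp

end Reduction

/-! ### Normalizing weights to sup norm one. -/

section Normalization

variable {ι : Type*} [Fintype ι]

/-- The multiple of `p` of norm one. -/
def unitize (p : ι → ℝ) : ι → ℝ := ‖p‖⁻¹ • p

lemma unitize_smul {c : ℝ} (hc : 0 < c) (p : ι → ℝ) : unitize (c • p) = unitize p := by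
  rw [unitize, norm_smul, Real.norm_of_nonneg hc.le, smul_smul, mul_inv, mul_assoc, mul_comm,
    mul_assoc, mul_inv_cancel₀ hc.ne', mul_one, unitize]

lemma unitize_of_norm {p : ι → ℝ} (hp : ‖p‖ = 1) : unitize p = p := by simp [unitize, hp]

lemma norm_unitize {p : ι → ℝ} (hp : p ≠ 0) : ‖unitize p‖ = 1 := by
  rw [unitize, norm_smul, norm_inv, norm_norm, inv_mul_cancel₀ (norm_ne_zero_iff.2 hp)]

lemma unitize_nonneg {p : ι → ℝ} (hp : 0 ≤ p) : 0 ≤ unitize p :=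
  smul_nonneg (inv_nonneg.2 (norm_nonneg _)) hp

lemma eq_smul_of_unitize_eq {p q : ι → ℝ} (hp : p ≠ 0) (hq : q ≠ 0)
    (h : unitize p = unitize q) : ∃ c : ℝ, 0 < c ∧ q = c • p := by
  refine ⟨‖q‖ * ‖p‖⁻¹, mul_pos (norm_pos_iff.2 hq) (inv_pos.2 (norm_pos_iff.2 hp)), ?_⟩
  rw [mul_smul]
  change q = ‖q‖ • unitize p
  rw [h, unitize, smul_smul, mul_inv_cancel₀ (norm_ne_zero_iff.2 hq), one_smul]

lemma continuousAt_unitize {p : ι → ℝ} (hp : p ≠ 0) : ContinuousAt unitize p :=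
  (continuous_norm.continuousAt.inv₀ (norm_ne_zero_iff.2 hp)).smul continuousAt_id

end Normalization

/-! ### The compactified apartment as part of a sphere. -/

section Coordinates

variable {n : ℕ}

/-- The weights `exp (-x_i)` of a point of `A_I`, extended by zero outside `I`. -/
def expWeight (I : Finset (Fin n)) (x : Fin n → ℝ) : Fin n → ℝ :=
  fun i => if i ∈ I then Real.exp (-x i) else 0

lemma expWeight_nonneg (I : Finset (Fin n)) (x : Fin n → ℝ) : 0 ≤ expWeight I x := fun i => by
  unfold expWeight
  split_ifs
  exacts [(Real.exp_pos _).le, le_rfl]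

lemma expWeight_pos_iff {I : Finset (Fin n)} {x : Fin n → ℝ} {i : Fin n} :
    0 < expWeight I x i ↔ i ∈ I := by
  unfold expWeight
  split_ifs with h <;> simp [h, Real.exp_pos]

lemma expWeight_ne_zero {I : Finset (Fin n)} (hI : I.Nonempty) (x : Fin n → ℝ) :
    expWeight I x ≠ 0 := by
  obtain ⟨i, hi⟩ := hI
  exact fun h => (expWeight_pos_iff.2 hi).ne' (congrFun h i)

lemma exists_eq_incl (ξ : ABar n) : ∃ (I : Finset (Fin n)) (hI : I.Nonempty) (x : Fin n → ℝ),
    ξ = ABar.incl I hI (Apt.mk I x) := by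
  obtain ⟨⟨I, hI⟩, z⟩ := ξ
  obtain ⟨x, rfl⟩ := Submodule.mkQ_surjective _ z
  exact ⟨I, hI, x, rfl⟩

lemma exists_mk_eq {I : Finset (Fin n)} (z : Apt I) : ∃ x, Apt.mk I x = z :=
  Submodule.mkQ_surjective _ z

/-- The normalized weights of a point of the compactified apartment. -/
def coords (ξ : ABar n) : Fin n → ℝ := unitize (expWeight ξ.1.1 (exists_mk_eq ξ.2).choose)

lemma Apt.mk_eq_mk_iff {I : Finset (Fin n)} {x y : Fin n → ℝ} :
    Apt.mk I x = Apt.mk I y ↔ x - y ∈ constOn I := Submodule.Quotient.eq _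

lemma Apt.mk_add_const (I : Finset (Fin n)) (x : Fin n → ℝ) (c : ℝ) :
    Apt.mk I (fun i => x i + c) = Apt.mk I x :=
  Apt.mk_eq_mk_iff.2 fun i _ j _ => by simp

/-- Two representatives differ by a constant on `I`, so their weights differ by a positive factor.
This makes `coords` independent of the chosen representative. -/
lemma unitize_expWeight_eq {I : Finset (Fin n)} (hI : I.Nonempty) {x y : Fin n → ℝ}
    (h : Apt.mk I x = Apt.mk I y) : unitize (expWeight I x) = unitize (expWeight I y) := by
  obtain ⟨i₀, hi₀⟩ := hI
  have h1 := Apt.mk_eq_mk_iff.1 h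
  rw [← unitize_smul (Real.exp_pos (-(x i₀ - y i₀))) (expWeight I y)]
  congr 1
  funext i
  by_cases hi : i ∈ I
  · have h2 : x i - y i = x i₀ - y i₀ := h1 i hi i₀ hi₀
    simp only [expWeight, hi, if_true, Pi.smul_apply, smul_eq_mul, ← Real.exp_add]
    congr 1
    linarith
  · simp [expWeight, hi]

lemma coords_incl (I : Finset (Fin n)) (hI : I.Nonempty) (x : Fin n → ℝ) :
    coords (ABar.incl I hI (Apt.mk I x)) = unitize (expWeight I x) :=
  unitize_expWeight_eq hI (exists_mk_eq (ABar.incl I hI (Apt.mk I x)).2).choose_spec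

lemma coords_nonneg (ξ : ABar n) : 0 ≤ coords ξ := unitize_nonneg (expWeight_nonneg _ _)

lemma norm_coords (ξ : ABar n) : ‖coords ξ‖ = 1 := norm_unitize (expWeight_ne_zero ξ.1.2 _)

lemma coords_ne_zero (ξ : ABar n) : coords ξ ≠ 0 := fun h => by
  have := norm_coords ξ
  simp [h] at this

/-- The support of the weights recovers `I`, and their logarithms recover the point of `A_I` up to a
common constant. -/
lemma coords_injective : Function.Injective (coords : ABar n → Fin n → ℝ) := by
  intro ξ η h
  obtain ⟨I, hI, x, rfl⟩ := exists_eq_incl ξ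
  obtain ⟨J, hJ, y, rfl⟩ := exists_eq_incl η
  rw [coords_incl, coords_incl] at h
  obtain ⟨c, hc, h⟩ := eq_smul_of_unitize_eq (expWeight_ne_zero hI x) (expWeight_ne_zero hJ y) h
  obtain rfl : I = J := by
    ext i
    rw [← expWeight_pos_iff (x := x), ← expWeight_pos_iff (x := y), h, Pi.smul_apply, smul_eq_mul,
      mul_pos_iff_of_pos_left hc]
  congr 1
  have h1 : ∀ i ∈ I, x i - y i = Real.log c := fun i hi => by
    have h2 := congrFun h i
    simp only [expWeight, hi, if_true, Pi.smul_apply, smul_eq_mul] at h2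
    have h3 := congrArg Real.log h2
    rw [Real.log_mul hc.ne' (Real.exp_pos _).ne', Real.log_exp, Real.log_exp] at h3
    linarith
  exact Apt.mk_eq_mk_iff.2 fun i hi j hj => by simp [h1 i hi, h1 j hj]

lemma exists_expWeight_eq {p : Fin n → ℝ} (hp : 0 ≤ p) (I : Finset (Fin n))
    (hI : ∀ i, i ∈ I ↔ 0 < p i) : expWeight I (fun i => -Real.log (p i)) = p := by
  funext i
  by_cases hi : i ∈ I
  · simp [expWeight, hi, Real.exp_log ((hI i).1 hi)]
  · simp only [expWeight, hi, if_false]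
    exact le_antisymm (hp i) (not_lt.1 fun h => hi ((hI i).2 h))

lemma exists_coords_eq {p : Fin n → ℝ} (hp : 0 ≤ p) (hp0 : p ≠ 0) :
    ∃ ξ, coords ξ = unitize p := by
  classical
  let I : Finset (Fin n) := Finset.univ.filter fun i => 0 < p i
  have hI : I.Nonempty := by
    by_contra h
    refine hp0 (funext fun i => le_antisymm (not_lt.1 fun h' => h ⟨i, ?_⟩) (hp i))
    simpa [I] using h'
  refine ⟨ABar.incl I hI (Apt.mk I fun i => -Real.log (p i)), ?_⟩
  rw [coords_incl, exists_expWeight_eq hp I fun i => by simp [I]]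

lemma range_coords : Set.range (coords : ABar n → Fin n → ℝ) = {p | 0 ≤ p ∧ ‖p‖ = 1} := by
  ext p
  constructor
  · rintro ⟨ξ, rfl⟩
    exact ⟨coords_nonneg ξ, norm_coords ξ⟩
  · rintro ⟨hp, hp1⟩
    obtain ⟨ξ, hξ⟩ := exists_coords_eq hp (by rintro rfl; simp at hp1)
    exact ⟨ξ, hξ.trans (unitize_of_norm hp1)⟩

lemma isOpenQuotientMap_mk : IsOpenQuotientMap (A.mk : (Fin n → ℝ) → A n) :=
  Submodule.isOpenQuotientMap_mkQ _

lemma isBounded_mk_image {B : Set (Fin n → ℝ)} (hB : Bornology.IsBounded B) :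
    Bornology.IsBounded (A.mk '' B) := by
  obtain ⟨C, hC⟩ := isBounded_iff_forall_norm_le.1 hB
  refine isBounded_iff_forall_norm_le.2 ⟨C, ?_⟩
  rintro _ ⟨y, hy, rfl⟩
  exact (Submodule.Quotient.norm_mk_le _ y).trans (hC y hy)

lemma continuous_expWeight (I : Finset (Fin n)) : Continuous (expWeight I) := by
  refine continuous_pi fun i => ?_
  unfold expWeight
  split_ifs <;> fun_prop

lemma isCompact_range_coords : IsCompact (Set.range (coords : ABar n → Fin n → ℝ)) := by
  rw [range_coords]
  refine (isCompact_sphere (0 : Fin n → ℝ) 1).of_isClosed_subset ?_ fun p hp => by simpa using hp.2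
  exact isClosed_Ici.inter (isClosed_eq continuous_norm continuous_const)

variable [NeZero n]

instance : Nonempty (ABar n) := ⟨ABar.ofA 0⟩

/-- The point of the compactified apartment with given weights. -/
def ofWeight (p : Fin n → ℝ) : ABar n := Function.invFun coords (unitize p)

lemma coords_ofWeight {p : Fin n → ℝ} (hp : 0 ≤ p) (hp0 : p ≠ 0) :
    coords (ofWeight p) = unitize p :=
  Function.invFun_eq (exists_coords_eq hp hp0)

lemma coords_ofA (x : Fin n → ℝ) :
    coords (ABar.ofA (A.mk x)) = unitize (expWeight Finset.univ x) := coords_incl _ _ _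

lemma mem_range_ofA_iff {ξ : ABar n} : ξ ∈ Set.range ABar.ofA ↔ ∀ i, 0 < coords ξ i := by
  constructor
  · rintro ⟨z, rfl⟩ i
    obtain ⟨x, rfl⟩ := exists_mk_eq z
    rw [coords_ofA]
    exact mul_pos (inv_pos.2 (norm_pos_iff.2 (expWeight_ne_zero Finset.univ_nonempty x)))
      (expWeight_pos_iff.2 (Finset.mem_univ i))
  · intro h
    refine ⟨A.mk fun i => -Real.log (coords ξ i), coords_injective ?_⟩
    rw [coords_ofA, exists_expWeight_eq (coords_nonneg ξ) _ fun i => by simp [h i],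
      unitize_of_norm (norm_coords ξ)]

lemma ofA_injective : Function.Injective (ABar.ofA : A n → ABar n) := fun _ _ h =>
  eq_of_heq (Sigma.mk.inj h).2

lemma coords_zero : coords (ABar.ofA (0 : A n)) = 1 := by
  have h : expWeight Finset.univ (0 : Fin n → ℝ) = 1 := by
    funext i
    simp [expWeight]
  rw [← map_zero (A.mk : (Fin n → ℝ) →ₗ[ℝ] A n), coords_ofA, h, unitize_of_norm]
  exact norm_one

/-! ### The topology in coordinates -/

/-- The part in `A` is the case `J = univ`, where `s_J` is the identity; all strata can thus be
handled at once. -/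
lemma mem_Gam_iff {I : Finset (Fin n)} {U : Set (A n)} {ξ : ABar n} :
    ξ ∈ Gam I U ↔ ∃ (J : Finset (Fin n)) (hJ : J.Nonempty) (y c : Fin n → ℝ), I ⊆ J ∧
      A.mk y ∈ U ∧ 0 ≤ c ∧ (∀ i ∈ I, c i = 0) ∧ ξ = ABar.incl J hJ (Apt.mk J (y + c)) := by
  constructor
  · rintro (⟨_, ⟨z, hz, _, ⟨c, hc, hcI, rfl⟩, rfl⟩, rfl⟩ |
      ⟨J, hJ, hIJ, -, _, ⟨z, hz, _, ⟨c, hc, hcI, rfl⟩, rfl⟩, rfl⟩)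
    · obtain ⟨y, rfl⟩ := exists_mk_eq z
      exact ⟨Finset.univ, Finset.univ_nonempty, y, c, Finset.subset_univ I, hz, hc, hcI, rfl⟩
    · obtain ⟨y, rfl⟩ := exists_mk_eq z
      exact ⟨J, hJ, y, c, hIJ, hz, hc, hcI, rfl⟩
  · rintro ⟨J, hJ, y, c, hIJ, hy, hc, hcI, rfl⟩
    by_cases h : J = Finset.univ
    · subst h
      exact Or.inl ⟨A.mk (y + c), ⟨A.mk y, hy, A.mk c, ⟨c, hc, hcI, rfl⟩, rfl⟩, rfl⟩
    · exact Or.inr ⟨J, hJ, hIJ, h, A.mk (y + c),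
        ⟨A.mk y, hy, A.mk c, ⟨c, hc, hcI, rfl⟩, rfl⟩, rfl⟩

/-- Near a boundary point of `A_I` take `Γ_U^I` with `U` a box close to `x` in the directions of `I`
and far out in the others. Adding `Δ_I` or passing to a stratum `J ⊇ I` keeps the weights in `I` and
only decreases the remaining, already small, ones. -/
lemma continuous_coords : Continuous (coords : ABar n → Fin n → ℝ) := by
  refine continuous_iff_continuousAt.2 fun ξ => ?_
  obtain ⟨I, hI, x, rfl⟩ := exists_eq_incl ξ
  intro O hO
  rw [coords_incl] at hO
  rw [Filter.mem_map, mem_nhds_iff]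
  by_cases hIu : I = Finset.univ
  · subst hIu
    obtain ⟨O', hO', hopen, hmem⟩ := mem_nhds_iff.1 hO
    refine ⟨ABar.ofA '' {z | coords (ABar.ofA z) ∈ O'}, ?_, ?_, ?_⟩
    · rintro _ ⟨z, hz, rfl⟩
      exact hO' hz
    · refine TopologicalSpace.isOpen_generateFrom_of_mem (Or.inl ⟨_, ?_, rfl⟩)
      rw [← isOpenQuotientMap_mk.isQuotientMap.isOpen_preimage]
      have : (A.mk : (Fin n → ℝ) → A n) ⁻¹' {z | coords (ABar.ofA z) ∈ O'} =
          (fun y => unitize (expWeight Finset.univ y)) ⁻¹' O' := by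
        ext y
        change coords (ABar.ofA (A.mk y)) ∈ O' ↔ _
        rw [coords_ofA]
        rfl
      rw [this]
      refine hopen.preimage (continuous_iff_continuousAt.2 fun y => ?_)
      exact ContinuousAt.comp (f := expWeight Finset.univ)
        (continuousAt_unitize (expWeight_ne_zero Finset.univ_nonempty y))
        (continuous_expWeight _).continuousAt
    · exact ⟨Apt.mk _ x, by change coords (ABar.ofA (A.mk x)) ∈ O'; rwa [coords_ofA], rfl⟩
  · obtain ⟨δ, hδ, hball⟩ := Metric.mem_nhds_iff.1
      ((continuousAt_unitize (expWeight_ne_zero hI x)) hO)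
    obtain ⟨R, hR⟩ : ∃ R : ℝ, Real.exp (-R) < δ := by
      have := (Real.tendsto_exp_neg_atTop_nhds_zero).eventually (gt_mem_nhds hδ)
      exact this.exists
    -- The intervals around `x i`, and the upper end `R + 1`, serve only to make `U` bounded.
    let B : Fin n → Set ℝ := fun i =>
      if i ∈ I then {t | |Real.exp (-t) - Real.exp (-x i)| < δ} ∩ Set.Ioo (x i - 1) (x i + 1)
      else Set.Ioo R (R + 1)
    have hBo : ∀ i, IsOpen (B i) := fun i => by
      simp only [B]
      split_ifs
      · exact (isOpen_lt (by fun_prop) continuous_const).inter isOpen_Ioo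
      · exact isOpen_Ioo
    have hBb : ∀ i, Bornology.IsBounded (B i) := fun i => by
      simp only [B]
      split_ifs
      · exact (Metric.isBounded_Ioo _ _).subset Set.inter_subset_right
      · exact Metric.isBounded_Ioo _ _
    let U : Set (A n) := A.mk '' Set.univ.pi B
    refine ⟨Gam I U, ?_, ?_, ?_⟩
    · intro η hη
      obtain ⟨J, hJ, y, c, hIJ, hy, hc, hcI, rfl⟩ := mem_Gam_iff.1 hη
      obtain ⟨y', hy', hyy'⟩ := hy
      have heq : Apt.mk J (y + c) = Apt.mk J (y' + c) :=
        Apt.mk_eq_mk_iff.2 fun i _ j _ => by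
          have := Apt.mk_eq_mk_iff.1 hyy'.symm i (Finset.mem_univ i) j (Finset.mem_univ j)
          simpa using this
      rw [Set.mem_preimage, heq, coords_incl]
      apply hball
      rw [Metric.mem_ball, dist_pi_lt_iff hδ]
      intro i
      have hyi := hy' i (Set.mem_univ i)
      by_cases hi : i ∈ I
      · simp only [B, hi, if_true] at hyi
        simp only [expWeight, hi, hIJ hi, if_true, Pi.add_apply, hcI i hi, add_zero]
        exact hyi.1
      · simp only [B, hi, if_false] at hyi
        simp only [expWeight, hi, if_false]
        rw [dist_zero_right]
        split_ifs
        · rw [Real.norm_of_nonneg (Real.exp_pos _).le]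
          refine lt_of_le_of_lt (Real.exp_le_exp.2 ?_) hR
          have := hc i
          simp only [Pi.zero_apply] at this
          simp only [Pi.add_apply]
          linarith [hyi.1]
        · simpa using hδ
    · exact TopologicalSpace.isOpen_generateFrom_of_mem (Or.inr ⟨I, U, hI, hIu,
        isOpenQuotientMap_mk.isOpenMap _ (isOpen_set_pi Set.finite_univ fun i _ => hBo i),
        isBounded_mk_image (Bornology.IsBounded.pi hBb), rfl⟩)
    · refine mem_Gam_iff.2 ⟨I, hI, fun i => if i ∈ I then x i else R + 1 / 2, 0, subset_rfl,
        ⟨_, fun i _ => ?_, rfl⟩, le_rfl, fun _ _ => rfl, ?_⟩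
      · by_cases hi : i ∈ I
        · simp [B, hi, hδ]
        · simp only [B, hi, if_false, Set.mem_Ioo]
          constructor <;> linarith
      · congr 1
        exact Apt.mk_eq_mk_iff.2 fun i hi j hj => by simp [hi, hj]

/-- Besides continuity, each generating open set must contain a `coords`-preimage of a neighbourhood
around each of its points. On `A` the logarithm inverts `coords`; for `Γ_U^I` a truncated logarithm,
continuous also where weights vanish, produces the `U`-component. -/
lemma isInducing_coords : IsInducing (coords : ABar n → Fin n → ℝ) := by
  refine ⟨le_antisymm continuous_coords.le_induced (le_generateFrom ?_)⟩
  have hlog : ∀ {p : Fin n → ℝ} {i : Fin n}, 0 < p i →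
      ContinuousAt (fun q : Fin n → ℝ => -Real.log (q i)) p := fun {p i} hpi => by
    have h : ContinuousAt (fun q : Fin n → ℝ => q i) p := (continuous_apply i).continuousAt
    exact (h.log hpi.ne').neg
  have hopen : ∀ G : Set (ABar n), (∀ ξ ∈ G, ∃ O ∈ 𝓝 (coords ξ), coords ⁻¹' O ⊆ G) →
      IsOpen[TopologicalSpace.induced coords inferInstance] G := by
    intro G h
    refine (@isOpen_iff_mem_nhds _ (TopologicalSpace.induced coords inferInstance) G).2
      fun ξ hξ => ?_
    rw [nhds_induced]
    exact h ξ hξ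
  rintro G (⟨U, hU, rfl⟩ | ⟨I, U, hI, hIu, hU, -, rfl⟩)
  · refine hopen _ ?_
    rintro _ ⟨z, hz, rfl⟩
    have hpos := mem_range_ofA_iff.1 ⟨z, rfl⟩
    have hinv : ∀ ξ : ABar n, (∀ i, 0 < coords ξ i) →
        ABar.ofA (A.mk fun i => -Real.log (coords ξ i)) = ξ := fun ξ h =>
      coords_injective (by
        rw [coords_ofA, exists_expWeight_eq (coords_nonneg ξ) _ fun i => by simp [h i],
          unitize_of_norm (norm_coords ξ)])
    have hL : ContinuousAt (fun q : Fin n → ℝ => A.mk fun i => -Real.log (q i))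
        (coords (ABar.ofA z)) :=
      ContinuousAt.comp (g := (A.mk : (Fin n → ℝ) → A n))
        isOpenQuotientMap_mk.continuous.continuousAt
        (continuousAt_pi.2 fun i => hlog (hpos i))
    have hU' : U ∈ 𝓝 (A.mk fun i => -Real.log (coords (ABar.ofA z) i)) := by
      rw [ofA_injective (hinv _ hpos)]
      exact hU.mem_nhds hz
    have hpos' : ∀ᶠ q in 𝓝 (coords (ABar.ofA z)), ∀ i, 0 < q i :=
      Filter.eventually_all.2 fun i =>
        (continuous_apply i).continuousAt.eventually (lt_mem_nhds (hpos i))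
    refine ⟨_, Filter.inter_mem (hL hU') hpos', ?_⟩
    rintro ξ ⟨h1, h2⟩
    exact ⟨_, h1, hinv ξ h2⟩
  · refine hopen _ fun ξ hξ => ?_
    obtain ⟨J, hJ, y, c, hIJ, hy, hc, hcI, rfl⟩ := mem_Gam_iff.1 hξ
    set p := coords (ABar.incl J hJ (Apt.mk J (y + c))) with hp
    rw [coords_incl] at hp
    set r := ‖expWeight J (y + c)‖⁻¹ with hr
    have hr0 : 0 < r := inv_pos.2 (norm_pos_iff.2 (expWeight_ne_zero hJ _))
    -- Shifting by a constant absorbs the normalization: the class in `A` is unchanged, while the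
    -- normalized weights become `exp (-y' i)` on `I` and at most that elsewhere.
    let y' : Fin n → ℝ := fun i => y i + -Real.log r
    have hy' : A.mk y' ∈ U := by
      have : A.mk y' = A.mk y := Apt.mk_add_const _ y _
      rwa [this]
    have hexp : ∀ t, r * Real.exp (-t) = Real.exp (-(t + -Real.log r)) := fun t => by
      rw [neg_add, neg_neg, Real.exp_add, Real.exp_log hr0, mul_comm]
    have hpI : ∀ i ∈ I, p i = Real.exp (-y' i) := fun i hi => by
      rw [hp, unitize, ← hr, Pi.smul_apply, smul_eq_mul, expWeight, if_pos (hIJ hi), hexp,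
        Pi.add_apply, hcI i hi, add_zero]
    have hpn : ∀ i, p i ≤ Real.exp (-y' i) := fun i => by
      rw [hp, unitize, ← hr, Pi.smul_apply, smul_eq_mul, expWeight]
      split_ifs
      · rw [hexp, Real.exp_le_exp, Pi.add_apply]
        have := hc i
        simp only [Pi.zero_apply] at this
        simp only [y']
        linarith
      · rw [mul_zero]
        exact (Real.exp_pos _).le
    -- Outside `I` the weight is truncated from below at `exp (-y' i)`. The truncation is inactive
    -- at `p` in the sense that `L p = y'`, and the part cut off is a non-negative element of `Δ_I`.
    let L : (Fin n → ℝ) → Fin n → ℝ := fun q i =>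
      if i ∈ I then -Real.log (q i) else -Real.log (max (Real.exp (-y' i)) (q i))
    have hLp : L p = y' := by
      funext i
      simp only [L]
      split_ifs with hi
      · rw [hpI i hi, Real.log_exp, neg_neg]
      · rw [max_eq_left (hpn i), Real.log_exp, neg_neg]
    have hLc : ContinuousAt L p := by
      refine continuousAt_pi.2 fun i => ?_
      simp only [L]
      split_ifs with hi
      · exact hlog (by rw [hpI i hi]; exact Real.exp_pos _)
      · have h : ContinuousAt (fun q : Fin n → ℝ => max (Real.exp (-y' i)) (q i)) p :=
          (continuous_const.max (continuous_apply i)).continuousAt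
        exact (h.log (lt_max_of_lt_left (Real.exp_pos _)).ne').neg
    have hU' : U ∈ 𝓝 (A.mk (L p)) := by
      rw [hLp]
      exact hU.mem_nhds hy'
    have hmk : ContinuousAt (fun q => A.mk (L q)) p :=
      ContinuousAt.comp (g := (A.mk : (Fin n → ℝ) → A n))
        isOpenQuotientMap_mk.continuous.continuousAt hLc
    have hpos : ∀ᶠ q in 𝓝 p, ∀ i, i ∈ I → 0 < q i :=
      Filter.eventually_all.2 fun i => by
        by_cases hi : i ∈ I
        · have : 0 < p i := by rw [hpI i hi]; exact Real.exp_pos _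
          filter_upwards [(continuous_apply i).continuousAt.eventually (lt_mem_nhds this)]
            with q hq _ using hq
        · simp [hi]
    refine ⟨_, Filter.inter_mem (hmk hU') hpos, ?_⟩
    rintro η ⟨h1, h2⟩
    obtain ⟨J', hJ', x', rfl⟩ := exists_eq_incl η
    set q := coords (ABar.incl J' hJ' (Apt.mk J' x')) with hq
    have hq0 : 0 ≤ q := coords_nonneg _
    have hsupp : ∀ i, i ∈ J' ↔ 0 < q i := fun i => by
      rw [hq, coords_incl, ← expWeight_pos_iff (I := J') (x := x'), unitize, Pi.smul_apply,
        smul_eq_mul, mul_pos_iff_of_pos_left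
          (inv_pos.2 (norm_pos_iff.2 (expWeight_ne_zero hJ' x')))]
    -- Outside `J'` the weight is 0 and its logarithm meaningless, but those coordinates do not
    -- affect the point of `A_{J'}`, so 0 is used there.
    refine mem_Gam_iff.2 ⟨J', hJ', L q, fun i => if i ∈ J' \ I then -Real.log (q i) - L q i else 0,
      fun i hi => (hsupp i).2 (h2 i hi), h1, fun i => ?_, fun i hi => by simp [hi], ?_⟩
    · simp only [Pi.zero_apply]
      split_ifs with hi
      · rw [Finset.mem_sdiff] at hi
        simp only [L, hi.2, if_false]
        have := Real.log_le_log ((hsupp i).1 hi.1) (le_max_right (Real.exp (-y' i)) (q i))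
        linarith
      · exact le_rfl
    · refine coords_injective (Eq.trans (unitize_of_norm (norm_coords _)).symm
        (Eq.trans (congrArg unitize ?_) (coords_incl J' hJ' _).symm))
      funext i
      change q i = _
      by_cases hi : i ∈ J'
      · have hqi := (hsupp i).1 hi
        by_cases hiI : i ∈ I
        · simp [expWeight, hi, hiI, L, Real.exp_log hqi]
        · simp [expWeight, hi, hiI, Real.exp_log hqi]
      · simp only [expWeight, hi, if_false]
        exact le_antisymm (not_lt.1 fun h => hi ((hsupp i).2 h)) (hq0 i)

instance : CompactSpace (ABar n) :=
  ⟨by rw [isInducing_coords.isCompact_iff, Set.image_univ]; exact isCompact_range_coords⟩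

lemma isOpenEmbedding_ofA : IsOpenEmbedding (ABar.ofA : A n → ABar n) := by
  refine IsOpenEmbedding.of_continuous_injective_isOpenMap ?_ ofA_injective fun U hU =>
    TopologicalSpace.isOpen_generateFrom_of_mem (Or.inl ⟨U, hU, rfl⟩)
  rw [isInducing_coords.continuous_iff, isOpenQuotientMap_mk.isQuotientMap.continuous_iff]
  have : coords ∘ ABar.ofA ∘ (A.mk : (Fin n → ℝ) → A n) =
      unitize ∘ expWeight Finset.univ := funext fun y => coords_ofA y
  rw [Function.comp_assoc, this]
  refine continuous_iff_continuousAt.2 fun y => ?_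
  exact ContinuousAt.comp (continuousAt_unitize (expWeight_ne_zero Finset.univ_nonempty y))
    (continuous_expWeight _).continuousAt

/-- Approximation of weights by positive weights. -/
lemma tendsto_ofWeight_add (ξ : ABar n) {r : Fin n → ℝ} (hr : 0 ≤ r) :
    Filter.Tendsto (fun ε : ℝ => ofWeight (coords ξ + ε • r)) (𝓝[>] 0) (𝓝 ξ) := by
  rw [isInducing_coords.tendsto_nhds_iff]
  have h1 : ContinuousAt (fun ε : ℝ => unitize (coords ξ + ε • r)) 0 := by
    refine ContinuousAt.comp (g := unitize) (f := fun ε : ℝ => coords ξ + ε • r) ?_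
      (continuous_const.add (continuous_id.smul continuous_const)).continuousAt
    simpa using continuousAt_unitize (coords_ne_zero ξ)
  have h2 : Filter.Tendsto (fun ε : ℝ => unitize (coords ξ + ε • r)) (𝓝[>] 0)
      (𝓝 (coords ξ)) := by
    have := h1.tendsto.mono_left (nhdsWithin_le_nhds (s := Set.Ioi 0))
    rwa [zero_smul, add_zero, unitize_of_norm (norm_coords ξ)] at this
  refine h2.congr' ?_
  filter_upwards [self_mem_nhdsWithin] with ε hε
  have hε' : (0 : ℝ) ≤ ε := le_of_lt hε
  have h3 : coords ξ ≤ coords ξ + ε • r := le_add_of_nonneg_right (smul_nonneg hε' hr)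
  refine (coords_ofWeight ((coords_nonneg ξ).trans h3) fun h => coords_ne_zero ξ ?_).symm
  exact le_antisymm (h ▸ h3) (coords_nonneg ξ)

lemma coords_ofWeight_add_eq (ξ : ABar n) {r : Fin n → ℝ} (hr : ∀ i, 0 < r i) {ε : ℝ}
    (hε : 0 < ε) : ∃ c : ℝ, 0 < c ∧
      coords (ofWeight (coords ξ + ε • r)) = c • (coords ξ + ε • r) := by
  have h3 : ∀ i, 0 < (coords ξ + ε • r) i := fun i =>
    add_pos_of_nonneg_of_pos (coords_nonneg ξ i) (mul_pos hε (hr i))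
  have h4 : coords ξ + ε • r ≠ 0 := fun h => by
    have := h3 0
    rw [h] at this
    exact lt_irrefl _ this
  exact ⟨_, inv_pos.2 (norm_pos_iff.2 h4), coords_ofWeight (fun i => (h3 i).le) h4⟩

/-- Adding `ε` to every weight makes them all positive, which characterizes `A`. -/
lemma denseRange_ofA : DenseRange (ABar.ofA : A n → ABar n) := by
  intro ξ
  refine mem_closure_of_tendsto (tendsto_ofWeight_add ξ (r := 1) zero_le_one) ?_
  filter_upwards [self_mem_nhdsWithin] with ε hε
  obtain ⟨c, hc, h⟩ := coords_ofWeight_add_eq ξ (r := 1) (fun _ => one_pos) hε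
  refine mem_range_ofA_iff.2 fun i => ?_
  rw [h]
  exact mul_pos hc (add_pos_of_nonneg_of_pos (coords_nonneg ξ i) (mul_pos hε one_pos))

/-! ### Closures of half-spaces and the function `fRoot`. -/

lemma le_root_iff (i j : Fin n) (t : ℝ) (z : A n) :
    -t ≤ root i j z ↔ coords (ABar.ofA z) i ≤ Real.exp t * coords (ABar.ofA z) j := by
  obtain ⟨x, rfl⟩ := exists_mk_eq z
  have h0 : 0 < ‖expWeight Finset.univ x‖⁻¹ :=
    inv_pos.2 (norm_pos_iff.2 (expWeight_ne_zero Finset.univ_nonempty x))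
  change -t ≤ x i - x j ↔ coords (ABar.ofA (A.mk x)) i ≤ _ * coords (ABar.ofA (A.mk x)) j
  rw [coords_ofA, unitize, Pi.smul_apply, Pi.smul_apply, smul_eq_mul, smul_eq_mul,
    mul_left_comm, mul_le_mul_iff_right₀ h0]
  simp only [expWeight, Finset.mem_univ, if_true]
  rw [← Real.exp_add, Real.exp_le_exp]
  constructor <;> intro h <;> linarith

lemma mem_closure_halfSpace_iff {i j : Fin n} (hij : i ≠ j) (t : ℝ) (ξ : ABar n) :
    ξ ∈ closure (ABar.ofA '' {z : A n | -t ≤ root i j z}) ↔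
      coords ξ i ≤ Real.exp t * coords ξ j := by
  constructor
  · intro h
    have hc : IsClosed {ξ : ABar n | coords ξ i ≤ Real.exp t * coords ξ j} :=
      isClosed_le ((continuous_apply i).comp continuous_coords)
        (continuous_const.mul ((continuous_apply j).comp continuous_coords))
    refine closure_minimal ?_ hc h
    rintro _ ⟨z, hz, rfl⟩
    exact (le_root_iff i j t z).1 hz
  · intro h
    -- The perturbation satisfies `r_i = exp t * r_j`, so adding it preserves the inequality while
    -- making all weights positive.
    let r : Fin n → ℝ := fun k => if k = i then Real.exp t else 1
    have hr : ∀ k, 0 < r k := fun k => by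
      simp only [r]
      split_ifs
      exacts [Real.exp_pos t, one_pos]
    refine mem_closure_of_tendsto (tendsto_ofWeight_add ξ fun k => (hr k).le) ?_
    filter_upwards [self_mem_nhdsWithin] with ε hε
    obtain ⟨c, hc, h'⟩ := coords_ofWeight_add_eq ξ hr hε
    obtain ⟨z, hz⟩ := mem_range_ofA_iff.2 fun k => by
      rw [h']
      exact mul_pos hc (add_pos_of_nonneg_of_pos (coords_nonneg ξ k) (mul_pos hε (hr k)))
    refine ⟨z, (le_root_iff i j t z).2 ?_, hz⟩
    rw [hz, h']
    simp only [Pi.smul_apply, Pi.add_apply, smul_eq_mul, r, if_true, if_neg hij.symm]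
    have := mul_le_mul_of_nonneg_left h hc.le
    linarith

lemma fRoot_eq (ξ : ABar n) {i j : Fin n} (hij : i ≠ j) :
    fRoot ξ i j = sInf {l : EReal | ∃ t : ℝ, l = (t : EReal) ∧
      coords ξ i ≤ Real.exp t * coords ξ j} := by
  simp only [fRoot, mem_closure_halfSpace_iff hij]

lemma fRoot_ofA (z : A n) {i j : Fin n} (hij : i ≠ j) :
    fRoot (ABar.ofA z) i j = ((-(root i j z) : ℝ) : EReal) := by
  rw [fRoot_eq _ hij]
  simp only [← le_root_iff]
  refine le_antisymm (sInf_le ⟨_, rfl, by simp⟩) (le_sInf ?_)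
  rintro _ ⟨t, rfl, ht⟩
  exact EReal.coe_le_coe_iff.2 (by linarith)

/-- The inequality is closed and monotone in `t`, so it passes to the infimum. Vanishing weights,
where `fRoot` may be infinite, need no separate treatment. -/
lemma fRoot_le_iff (ξ : ABar n) {i j : Fin n} (hij : i ≠ j) (m : ℝ) :
    fRoot ξ i j ≤ (m : EReal) ↔ coords ξ i ≤ Real.exp m * coords ξ j := by
  rw [fRoot_eq _ hij]
  refine ⟨fun h => ?_, fun h => sInf_le ⟨m, rfl, h⟩⟩
  have h1 : ∀ m' : ℝ, m < m' → coords ξ i ≤ Real.exp m' * coords ξ j := fun m' hm' => by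
    obtain ⟨_, ⟨t, rfl, ht⟩, hlt⟩ := sInf_lt_iff.1 (h.trans_lt (EReal.coe_lt_coe_iff.2 hm'))
    refine ht.trans (mul_le_mul_of_nonneg_right (Real.exp_le_exp.2 ?_) (coords_nonneg ξ j))
    exact (EReal.coe_lt_coe_iff.1 hlt).le
  have hc : Filter.Tendsto (fun t : ℝ => Real.exp t * coords ξ j) (𝓝[>] m)
      (𝓝 (Real.exp m * coords ξ j)) :=
    ((Real.continuous_exp.mul continuous_const).tendsto m).mono_left nhdsWithin_le_nhds
  refine ge_of_tendsto hc ?_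
  filter_upwards [self_mem_nhdsWithin] with t ht using h1 t ht

end Coordinates

lemma PGL.mk_surjective {K : Type*} [Field K] {V : Type*} [AddCommGroup V] [Module K V] :
    Function.Surjective (PGL.mk : _ → PGL K V) :=
  QuotientGroup.mk'_surjective _

/-! ### The equivalence relation as homothety of seminorms. -/

section Relation

variable {K : Type*} [Field K] [ValuativeRel K] [TopologicalSpace K]
  [IsNonarchimedeanLocalField K] {V : Type*} [AddCommGroup V] [Module K V] {n : ℕ}

lemma monoWeight_smul (d : Fin n → Kˣ) (w : Equiv.Perm (Fin n)) (c : ℝ) (p : Fin n → ℝ) :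
    monoWeight d w (c • p) = c • monoWeight d w p := by
  funext k
  simp only [monoWeight, Pi.smul_apply, smul_eq_mul]
  ring

lemma monoWeight_ne_zero (d : Fin n → Kˣ) (w : Equiv.Perm (Fin n)) {p : Fin n → ℝ} (hp : p ≠ 0) :
    monoWeight d w p ≠ 0 := fun h => hp (funext fun k => by
  have := congrFun h (w k)
  simpa [monoWeight, absK_eq_zero] using this)

/-- Translating by `-v(d_k)` multiplies the weight `exp (-x)` by `exp (v(d_k)) = |d_k|⁻¹`. -/
lemma coords_monoAct (d : Fin n → Kˣ) (w : Equiv.Perm (Fin n)) (ξ : ABar n) :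
    coords (monoAct d w ξ) = unitize (monoWeight d w (coords ξ)) := by
  obtain ⟨I, hI, x, rfl⟩ := exists_eq_incl ξ
  have h1 : monoAct d w (ABar.incl I hI (Apt.mk I x)) =
      ABar.incl (I.map w.toEmbedding) hI.map
        (Apt.mk (I.map w.toEmbedding) (x ∘ w.symm + negVal d)) := rfl
  have h2 : expWeight (I.map w.toEmbedding) (x ∘ w.symm + negVal d) =
      monoWeight d w (expWeight I x) := by
    funext k
    have hk : k ∈ I.map w.toEmbedding ↔ w.symm k ∈ I := by
      rw [Finset.mem_map_equiv]
    simp only [expWeight, monoWeight, hk]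
    split_ifs
    · rw [absK_of_ne_zero (d k).ne_zero, ← Real.exp_neg, ← Real.exp_add]
      congr 1
      simp only [Pi.add_apply, Function.comp_apply, negVal]
      ring
    · rw [mul_zero]
  rw [h1, coords_incl, h2, coords_incl]
  change _ = unitize (monoWeight d w (‖expWeight I x‖⁻¹ • expWeight I x))
  rw [monoWeight_smul, unitize_smul (inv_pos.2 (norm_pos_iff.2 (expWeight_ne_zero hI x)))]

variable (b : Module.Basis (Fin n) K V)

/-- The class of `g`-translates of the seminorm with weights `p` agrees with that of the
`h`-translate of the seminorm with weights `q`. -/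
def Homothetic (g : LinearMap.GeneralLinearGroup K V) (p : Fin n → ℝ)
    (h : LinearMap.GeneralLinearGroup K V) (q : Fin n → ℝ) : Prop :=
  ∃ c : ℝ, 0 < c ∧ ∀ x, wnorm b p ((g⁻¹).val x) = c * wnorm b q ((h⁻¹).val x)

lemma homothetic_of_mk_eq {g h : LinearMap.GeneralLinearGroup K V} (H : PGL.mk g = PGL.mk h)
    (p : Fin n → ℝ) [NeZero n] : Homothetic b g p h p := by
  have H' : PGL.mk h⁻¹ = PGL.mk g⁻¹ := by rw [map_inv, map_inv, H]
  obtain ⟨a, ha⟩ := exists_scalar_of_mk_eq b H'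
  have ha0 : a ≠ 0 := by
    rintro rfl
    have h0 : (g⁻¹).val (b 0) = 0 := by rw [ha]; simp
    exact b.ne_zero 0 (val_injective g⁻¹ (by rw [h0, map_zero]))
  refine ⟨absK a, absK_pos ha0, fun x => ?_⟩
  rw [ha, LinearMap.smul_apply, wnorm_smul]

/-- A seminorm vanishing on the basis `g v_j` vanishes everywhere, hence so do its weights. This
justifies the denominator in `normalizedGL`. -/
lemma norm_wnorm_basis_pos (g : LinearMap.GeneralLinearGroup K V) (ξ : ABar n) :
    0 < ‖fun j => wnorm b (coords ξ) (g.val (b j))‖ := by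
  refine (norm_nonneg _).lt_of_ne' fun h0 => coords_ne_zero ξ (funext fun i => ?_)
  refine le_antisymm ?_ (coords_nonneg ξ i)
  have h1 := wnorm_map_le b (coords_nonneg ξ) g.val ((g⁻¹).val (b i))
  rw [h0, mul_zero, ← Module.End.mul_apply, ← Units.val_mul, mul_inv_cancel] at h1
  rw [← wnorm_basis b (coords_nonneg ξ)]
  exact h1

lemma continuous_repr_inv (x : V) (i : Fin n) :
    @Continuous _ _ (glTopology K V) _
      (fun g : LinearMap.GeneralLinearGroup K V => b.repr ((g⁻¹).val x) i) := by
  let _ : TopologicalSpace (V →ₗ[K] V) := moduleTopology K (V →ₗ[K] V)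
  have : IsModuleTopology K (V →ₗ[K] V) := ⟨rfl⟩
  have h1 : Continuous ((b.coord i) ∘ₗ (LinearMap.applyₗ x : (V →ₗ[K] V) →ₗ[K] V)) :=
    IsModuleTopology.continuous_of_linearMap _
  exact h1.comp Units.continuous_coe_inv

/-- The seminorm with weights `p` translated by `g`, normalized on the basis. -/
def normalizedGL (g : LinearMap.GeneralLinearGroup K V) (ξ : ABar n) (x : V) : ℝ :=
  wnorm b (coords ξ) ((g⁻¹).val x) / ‖fun j => wnorm b (coords ξ) ((g⁻¹).val (b j))‖

lemma normalizedGL_eq_iff (g h : LinearMap.GeneralLinearGroup K V) (ξ η : ABar n) :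
    normalizedGL b g ξ = normalizedGL b h η ↔ Homothetic b g (coords ξ) h (coords η) := by
  have hg := norm_wnorm_basis_pos b g⁻¹ ξ
  have hh := norm_wnorm_basis_pos b h⁻¹ η
  constructor
  · intro H
    refine ⟨_, div_pos hg hh, fun x => ?_⟩
    have := congrFun H x
    rw [normalizedGL, normalizedGL, div_eq_iff hg.ne'] at this
    rw [this]
    ring
  · rintro ⟨c, hc, H⟩
    funext x
    have h1 : (fun j => wnorm b (coords ξ) ((g⁻¹).val (b j))) =
        c • fun j => wnorm b (coords η) ((h⁻¹).val (b j)) := funext fun j => H (b j)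
    rw [normalizedGL, normalizedGL, h1, norm_smul, Real.norm_of_nonneg hc.le, H,
      mul_div_mul_left _ _ hc.ne']

variable [NeZero n]

/-- Identifies the generators of `U_x` with the root elements in `rootSubgroup`, which preserve the
seminorm of `x`. -/
lemma fRoot_le_v_iff (ξ : ABar n) {i j : Fin n} (hij : i ≠ j) (ω : K) :
    fRoot ξ i j ≤ v ω ↔ absK ω * coords ξ i ≤ coords ξ j := by
  by_cases hω : ω = 0
  · subst hω
    simp only [absK_zero, zero_mul]
    exact ⟨fun _ => coords_nonneg ξ j, fun _ => by rw [v, if_pos rfl]; exact le_top⟩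
  · rw [v_eq_neg_log hω, fRoot_le_iff ξ hij, Real.exp_neg, Real.exp_log (absK_pos hω),
      inv_mul_eq_div, le_div_iff₀ (absK_pos hω), mul_comm]

lemma genU_fRoot (ξ : ABar n) :
    genU b (fRoot ξ) = (rootSubgroup b (coords ξ)).map PGL.mk := by
  rw [rootSubgroup, MonoidHom.map_closure, genU]
  congr 1
  simp only [Set.image_iUnion]
  refine Set.iUnion_congr fun i => Set.iUnion_congr fun j => Set.iUnion_congr fun h => ?_
  ext u
  constructor
  · rintro ⟨ω, rfl, hω⟩
    exact ⟨_, ⟨ω, rfl, (fRoot_le_v_iff ξ h ω).1 hω⟩, rfl⟩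
  · rintro ⟨_, ⟨ω, rfl, hω⟩, rfl⟩
    exact ⟨ω, rfl, (fRoot_le_v_iff ξ h ω).2 hω⟩

lemma PA_eq (x : A n) : PA b x = PBar b (ABar.ofA x) := by
  have : genU b (fun i j => ((-(root i j x) : ℝ) : EReal)) = genU b (fRoot (ABar.ofA x)) := by
    unfold genU
    congr 1
    exact Set.iUnion_congr fun i => Set.iUnion_congr fun j => Set.iUnion_congr fun h => by
      rw [fRoot_ofA x h]
  rw [PA, this, PBar]

/-- The factor `c` comes from renormalizing the transported weights. -/
lemma exists_of_nu_eq {m : N b} {ξ η : ABar n} (h : nu b m ξ = η) :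
    ∃ g : LinearMap.GeneralLinearGroup K V, PGL.mk g = m ∧ ∃ c : ℝ, 0 < c ∧
      ∀ x, wnorm b (coords η) (g.val x) = c * wnorm b (coords ξ) x := by
  obtain ⟨⟨d, w⟩, hm⟩ := exists_mono b m
  obtain rfl : m = ⟨mono b d w, mono_mem_N b d w⟩ := Subtype.ext hm
  rw [nu_mono] at h
  subst h
  have h0 : 0 < ‖monoWeight d w (coords ξ)‖⁻¹ :=
    inv_pos.2 (norm_pos_iff.2 (monoWeight_ne_zero d w (coords_ne_zero ξ)))
  refine ⟨monoGL b d w, rfl, _, h0, fun x => ?_⟩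
  rw [coords_monoAct, unitize, wnorm_smul_weight b h0.le, wnorm_monoGL b (coords_nonneg ξ)]

lemma exists_of_mem_PBar {ξ : ABar n} {g : PGL K V} (hg : g ∈ PBar b ξ) :
    ∃ h : LinearMap.GeneralLinearGroup K V, PGL.mk h = g ∧ ∃ c : ℝ, 0 < c ∧
      ∀ x, wnorm b (coords ξ) (h.val x) = c * wnorm b (coords ξ) x := by
  obtain ⟨u, hu, k, ⟨hk, hkξ⟩, rfl⟩ := hg
  rw [genU_fRoot] at hu
  obtain ⟨u, hu, rfl⟩ := hu
  obtain ⟨k', hk', c, hc, H⟩ := exists_of_nu_eq b hkξ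
  refine ⟨u * k', ?_, c, hc, fun x => ?_⟩
  · rw [map_mul, hk']
  · rw [Units.val_mul, Module.End.mul_apply, wnorm_rootSubgroup b (coords_nonneg ξ) hu, H]

lemma one_mem_Nstab (ξ : ABar n) : (1 : PGL K V) ∈ Nstab b ξ := by
  rw [← mono_one b]
  refine ⟨mono_mem_N b 1 1, ?_⟩
  rw [nu_mono]
  refine coords_injective ?_
  rw [coords_monoAct]
  have : monoWeight (1 : Fin n → Kˣ) 1 (coords ξ) = coords ξ := by
    funext k
    simp only [monoWeight, Pi.one_apply, Units.val_one, absK_one, inv_one, one_mul]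
    rfl
  rw [this, unitize_of_norm (norm_coords ξ)]

lemma mk_mem_PBar {ξ : ABar n} {u : LinearMap.GeneralLinearGroup K V}
    (hu : u ∈ rootSubgroup b (coords ξ)) : PGL.mk u ∈ PBar b ξ :=
  ⟨PGL.mk u, by rw [genU_fRoot]; exact ⟨u, hu, rfl⟩, 1, one_mem_Nstab b ξ, mul_one _⟩

/-- The equivalence relation in terms of seminorms. -/
lemma exists_nu_iff_homothetic (g h : LinearMap.GeneralLinearGroup K V) (ξ η : ABar n) :
    (∃ m : N b, nu b m ξ = η ∧ (PGL.mk g)⁻¹ * PGL.mk h * m ∈ PBar b ξ) ↔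
      Homothetic b g (coords ξ) h (coords η) := by
  constructor
  · rintro ⟨m, hm, hP⟩
    obtain ⟨m', hm', c₁, hc₁, H₁⟩ := exists_of_nu_eq b hm
    obtain ⟨k, hk, c₂, hc₂, H₂⟩ := exists_of_mem_PBar b hP
    rw [← hm', ← map_inv, ← map_mul, ← map_mul] at hk
    obtain ⟨a, ha⟩ := exists_scalar_of_mk_eq b hk
    have ha0 : a ≠ 0 := by
      rintro rfl
      have h0 : (g⁻¹ * h * m').val (b 0) = 0 := by rw [ha]; simp
      exact b.ne_zero 0 (val_injective _ (by rw [h0, map_zero]))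
    refine ⟨absK a * c₂ * c₁⁻¹, mul_pos (mul_pos (absK_pos ha0) hc₂) (inv_pos.2 hc₁),
      fun x => ?_⟩
    -- In the variable `y` the two sides are the seminorms of `g⁻¹ h m' y` and of `m' y`, each a
    -- known multiple of the seminorm of `y`.
    obtain ⟨y, rfl⟩ : ∃ y, x = (h * m').val y := ⟨((h * m')⁻¹).val x, by
      rw [← Module.End.mul_apply, ← Units.val_mul, mul_inv_cancel]; rfl⟩
    have e1 : (g⁻¹).val ((h * m').val y) = (g⁻¹ * h * m').val y := by
      rw [mul_assoc, Units.val_mul g⁻¹]; rfl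
    have e2 : (h⁻¹).val ((h * m').val y) = m'.val y := by
      rw [← Module.End.mul_apply, ← Units.val_mul, inv_mul_cancel_left]
    rw [e1, e2, ha, LinearMap.smul_apply, wnorm_smul, H₁, H₂]
    field_simp
  · rintro ⟨c, hc, H⟩
    have H' : ∀ x, wnorm b (coords ξ) ((g⁻¹ * h).val x) = c * wnorm b (coords η) x := fun x => by
      rw [Units.val_mul, Module.End.mul_apply, H, ← Module.End.mul_apply, ← Units.val_mul,
        inv_mul_cancel]
      rfl
    obtain ⟨u, hu, d, w, hgh, hw⟩ :=
      exists_eq_mul_monoGL b (coords_nonneg ξ) (coords_nonneg η) (g⁻¹ * h) hc H'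
    -- The inverse of the monomial factor: it carries `ξ` to `η` and leaves only the root part `u`
    -- of `g⁻¹ h`.
    refine ⟨⟨mono b (d⁻¹ ∘ w) w⁻¹, mono_mem_N b _ _⟩, ?_, ?_⟩
    · rw [nu_mono]
      refine coords_injective ?_
      have h1 : monoWeight (d⁻¹ ∘ w) w⁻¹ (monoWeight d w (coords η)) = coords η := by
        funext k
        have hinv : (w⁻¹).symm k = w k := rfl
        have := (absK_pos (d (w k)).ne_zero).ne'
        simp only [monoWeight, Function.comp_apply, Pi.inv_apply, Units.val_inv_eq_inv_val,
          absK_inv, inv_inv, hinv, Equiv.symm_apply_apply]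
        field_simp
      rw [coords_monoAct, ← hw, monoWeight_smul, unitize_smul hc, h1,
        unitize_of_norm (norm_coords η)]
    · have h1 : (PGL.mk g)⁻¹ * PGL.mk h = PGL.mk u * mono b d w := by
        rw [← map_inv, ← map_mul, hgh, map_mul]
        rfl
      have h2 : mono b d w * mono b (d⁻¹ ∘ w) w⁻¹ = 1 := by
        rw [mono_mul, mul_inv_cancel, ← mono_one b]
        congr 1
        funext k
        simp
      change (PGL.mk g)⁻¹ * PGL.mk h * mono b (d⁻¹ ∘ w) w⁻¹ ∈ _
      rw [h1, mul_assoc, h2, mul_one]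
      exact mk_mem_PBar b hu

/-! ### The normalized seminorm of a point -/

/-- The normalized seminorm of a pair in `PGL(V) × ABar`. -/
def normalized (g : PGL K V) (ξ : ABar n) : V → ℝ :=
  normalizedGL b (Function.surjInv PGL.mk_surjective g) ξ

lemma normalized_mk (g : LinearMap.GeneralLinearGroup K V) (ξ : ABar n) :
    normalized b (PGL.mk g) ξ = normalizedGL b g ξ :=
  (normalizedGL_eq_iff b _ _ _ _).2
    (homothetic_of_mk_eq b (Function.surjInv_eq PGL.mk_surjective _) _)

/-- The normalized seminorm is a complete invariant of the relation. It makes the maps to `V → ℝ`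
well defined and injective. -/
lemma normalized_eq_iff (g h : PGL K V) (ξ η : ABar n) :
    normalized b g ξ = normalized b h η ↔
      ∃ m : N b, nu b m ξ = η ∧ g⁻¹ * h * m ∈ PBar b ξ := by
  obtain ⟨g, rfl⟩ := PGL.mk_surjective g
  obtain ⟨h, rfl⟩ := PGL.mk_surjective h
  rw [normalized_mk, normalized_mk, normalizedGL_eq_iff, exists_nu_iff_homothetic]

/-! ### Continuity -/

/-- The largest absolute value of an entry of the inverse matrix. -/
def entryNorm (g : LinearMap.GeneralLinearGroup K V) : ℝ :=
  ‖fun i j => absK (b.repr ((g⁻¹).val (b i)) j)‖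

lemma entryNorm_pos (g : LinearMap.GeneralLinearGroup K V) : 0 < entryNorm b g := by
  refine norm_pos_iff.2 fun h => ?_
  have h0 : (g⁻¹).val (b 0) = 0 := b.repr.injective (Finsupp.ext fun k => ?_)
  · exact b.ne_zero 0 (val_injective g⁻¹ (h0.trans (map_zero _).symm))
  have := congrFun (congrFun h 0) k
  simpa using absK_eq_zero.1 this

/-- The absolute value of a coordinate of `g⁻¹ x`, normalized so as to be defined on `PGL(V)`. -/
def relCoord (g : PGL K V) (x : V) (i : Fin n) : ℝ :=
  absK (b.repr (((Function.surjInv PGL.mk_surjective g)⁻¹).val x) i) /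
    entryNorm b (Function.surjInv PGL.mk_surjective g)

/-- A scalar multiplies numerator and denominator equally, so any lift may be used; continuity on
`PGL(V)` can then be checked on `GL(V)`. -/
lemma relCoord_mk (g : LinearMap.GeneralLinearGroup K V) (x : V) (i : Fin n) :
    relCoord b (PGL.mk g) x i = absK (b.repr ((g⁻¹).val x) i) / entryNorm b g := by
  set h := Function.surjInv PGL.mk_surjective (PGL.mk g) with hh
  have H : PGL.mk g⁻¹ = PGL.mk h⁻¹ := by
    rw [map_inv, map_inv, hh, Function.surjInv_eq PGL.mk_surjective]
  obtain ⟨a, ha⟩ := exists_scalar_of_mk_eq b H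
  have h1 : ∀ y k, absK (b.repr ((h⁻¹).val y) k) = absK a * absK (b.repr ((g⁻¹).val y) k) :=
    fun y k => by rw [ha, LinearMap.smul_apply, map_smul, Finsupp.smul_apply, smul_eq_mul,
      absK_mul]
  have h2 : entryNorm b h = absK a * entryNorm b g := by
    have : (fun i j => absK (b.repr ((h⁻¹).val (b i)) j)) =
        absK a • fun i j => absK (b.repr ((g⁻¹).val (b i)) j) := by
      funext i j
      exact h1 _ _
    rw [entryNorm, this, norm_smul, Real.norm_of_nonneg (absK_nonneg a), entryNorm]
  have ha0 : absK a ≠ 0 := fun h0 => by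
    have := entryNorm_pos b h
    rw [h2, h0, zero_mul] at this
    exact lt_irrefl _ this
  rw [relCoord, ← hh, h1, h2, mul_div_mul_left _ _ ha0]

lemma continuous_relCoord (x : V) (i : Fin n) : Continuous fun g : PGL K V => relCoord b g x i := by
  refine continuous_coinduced_dom.2 ?_
  let _ := glTopology K V
  have h1 : ((fun g : PGL K V => relCoord b g x i) ∘ PGL.mk) = fun g =>
      absK (b.repr ((g⁻¹).val x) i) / entryNorm b g := funext fun g => relCoord_mk b g x i
  rw [h1]
  refine Continuous.div (continuous_absK.comp (continuous_repr_inv b x i)) ?_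
    fun g => (entryNorm_pos b g).ne'
  exact (continuous_pi fun i => continuous_pi fun j =>
    continuous_absK.comp (continuous_repr_inv b (b i) j)).norm

/-- The factor `entryNorm` cancels in the quotient. What remains is built from functions continuous
in `g` and in `ξ`, with nonzero denominator. -/
lemma normalized_apply (g : PGL K V) (ξ : ABar n) (x : V) :
    normalized b g ξ x = ‖fun i => relCoord b g x i * coords ξ i‖ /
      ‖fun j => ‖fun i => relCoord b g (b j) i * coords ξ i‖‖ ∧
    ‖fun j => ‖fun i => relCoord b g (b j) i * coords ξ i‖‖ ≠ 0 := by
  obtain ⟨g, rfl⟩ := PGL.mk_surjective g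
  have hM := inv_pos.2 (entryNorm_pos b g)
  have h1 : ∀ y, ‖fun i => relCoord b (PGL.mk g) y i * coords ξ i‖ =
      (entryNorm b g)⁻¹ * wnorm b (coords ξ) ((g⁻¹).val y) := fun y => by
    have : (fun i => relCoord b (PGL.mk g) y i * coords ξ i) =
        (entryNorm b g)⁻¹ • fun i => absK (b.repr ((g⁻¹).val y) i) * coords ξ i := by
      funext i
      rw [relCoord_mk, Pi.smul_apply, smul_eq_mul]
      ring
    rw [this, norm_smul, Real.norm_of_nonneg hM.le, wnorm]
  have h2 : ‖fun j => ‖fun i => relCoord b (PGL.mk g) (b j) i * coords ξ i‖‖ =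
      (entryNorm b g)⁻¹ * ‖fun j => wnorm b (coords ξ) ((g⁻¹).val (b j))‖ := by
    have : (fun j => ‖fun i => relCoord b (PGL.mk g) (b j) i * coords ξ i‖) =
        (entryNorm b g)⁻¹ • fun j => wnorm b (coords ξ) ((g⁻¹).val (b j)) :=
      funext fun j => h1 (b j)
    rw [this, norm_smul, Real.norm_of_nonneg hM.le]
  rw [h1, h2, normalized_mk, normalizedGL, mul_div_mul_left _ _ hM.ne']
  exact ⟨rfl, (mul_pos hM (norm_wnorm_basis_pos b g⁻¹ ξ)).ne'⟩

lemma continuous_normalized :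
    Continuous fun x : PGL K V × ABar n => normalized b x.1 x.2 := by
  refine continuous_pi fun x => ?_
  have h1 : ∀ y, Continuous fun z : PGL K V × ABar n =>
      ‖fun i => relCoord b z.1 y i * coords z.2 i‖ := fun y =>
    (continuous_pi fun i => ((continuous_relCoord b y i).comp continuous_fst).mul
      ((continuous_apply i).comp (continuous_coords.comp continuous_snd))).norm
  simp only [fun z : PGL K V × ABar n => (normalized_apply b z.1 z.2 x).1]
  exact (h1 x).div (continuous_pi fun j => h1 (b j)).norm
    fun z => (normalized_apply b z.1 z.2 x).2

end Relation

/-! ### Scalar invariance of monomial classes. -/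

section IntegralSubgroup

variable {K : Type*} [Field K] {V : Type*} [AddCommGroup V] [Module K V] {n : ℕ}
  (b : Module.Basis (Fin n) K V)

lemma mono_smul (c : Kˣ) (d : Fin n → Kˣ) (w : Equiv.Perm (Fin n)) :
    mono b (fun i => c * d i) w = mono b d w := by
  have hz : ∀ x, (monoGL b (fun _ => c) 1).val x = (c : K) • x := fun x => by
    have : (monoGL b (fun _ => c) 1).val = (c : K) • LinearMap.id := b.ext fun i => by
      rw [monoGL_apply]
      simp
    rw [this]
    rfl
  refine Eq.symm ((QuotientGroup.mk'_eq_mk' _).2 ⟨monoGL b (fun _ => c) 1, ?_, ?_⟩)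
  · refine Subgroup.mem_center_iff.2 fun g => gl_ext b fun i => ?_
    rw [Units.val_mul, Units.val_mul, Module.End.mul_apply, Module.End.mul_apply, hz, hz, map_smul]
  · refine gl_ext b fun i => ?_
    rw [Units.val_mul, Module.End.mul_apply, hz, map_smul, monoGL_apply, monoGL_apply, smul_smul,
      Units.val_mul]

end IntegralSubgroup

/-! ### The integral subgroup, compactness, the embedding and the contraction. -/

section MainTheorem

variable {K : Type*} [Field K] [ValuativeRel K] [TopologicalSpace K]
  [IsNonarchimedeanLocalField K] {V : Type*} [AddCommGroup V] [Module K V] {n : ℕ}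
  (b : Module.Basis (Fin n) K V)

lemma vInt_eq_zero_iff {x : K} (hx : x ≠ 0) : vInt x = 0 ↔ absK x = 1 := by
  rw [absK_of_ne_zero hx, Real.exp_eq_one_iff]
  simp

lemma wnorm_one_inv {g : LinearMap.GeneralLinearGroup K V}
    (hg : ∀ x, wnorm b 1 (g.val x) = wnorm b 1 x) (x : V) :
    wnorm b 1 ((g⁻¹).val x) = wnorm b 1 x := by
  rw [← hg, ← Module.End.mul_apply, ← Units.val_mul, mul_inv_cancel]
  rfl

lemma wnorm_one_le_of_entries {g : V →ₗ[K] V} (hg : ∀ i j, absK (b.repr (g (b j)) i) ≤ 1) (x : V) :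
    wnorm b 1 (g x) ≤ wnorm b 1 x := by
  refine (wnorm_map_le b zero_le_one g x).trans (mul_le_of_le_one_right (wnorm_nonneg _ _ _) ?_)
  refine (pi_norm_le_iff_of_nonneg zero_le_one).2 fun j => ?_
  rw [Real.norm_of_nonneg (wnorm_nonneg _ _ _), wnorm_le_iff b zero_le_one zero_le_one]
  simpa using fun i => hg i j

lemma entry_le_one {g : V →ₗ[K] V} (hg : ∀ x, wnorm b 1 (g x) = wnorm b 1 x) (i j : Fin n) :
    absK (b.repr (g (b j)) i) ≤ 1 := by
  have h := le_wnorm b 1 (g (b j)) i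
  rw [hg, wnorm_basis b zero_le_one] at h
  simpa using h

/-- Maxima of seminorms diagonal in one basis are again diagonal there; this keeps the contraction
inside the compactification. -/
lemma wnorm_sup (p : Fin n → ℝ) (hp : 0 ≤ p) {t : ℝ} (ht : 0 ≤ t) (x : V) :
    wnorm b (p ⊔ t • 1) x = max (wnorm b p x) (t * wnorm b 1 x) := by
  have hq : (0 : Fin n → ℝ) ≤ p ⊔ t • 1 := hp.trans le_sup_left
  refine le_antisymm ((wnorm_le_iff b hq (le_max_of_le_left (wnorm_nonneg _ _ _))).2 fun i => ?_)
    (max_le ((wnorm_le_iff b hp (wnorm_nonneg _ _ _)).2 fun i => ?_) ?_)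
  · rw [Pi.sup_apply, mul_max_of_nonneg _ _ (absK_nonneg _)]
    refine max_le_max (le_wnorm b p x i) ?_
    have := mul_le_mul_of_nonneg_left (le_wnorm b 1 x i) ht
    simp only [Pi.smul_apply, Pi.one_apply, smul_eq_mul, mul_one] at this ⊢
    linarith
  · exact (mul_le_mul_of_nonneg_left (le_max_left _ _) (absK_nonneg _)).trans
      (le_wnorm b (p ⊔ t • 1) x i)
  · rw [← wnorm_smul_weight b ht]
    exact (wnorm_le_iff b (smul_nonneg ht zero_le_one) (wnorm_nonneg _ _ _)).2 fun i =>
      (mul_le_mul_of_nonneg_left (le_max_right _ _) (absK_nonneg _)).trans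
        (le_wnorm b (p ⊔ t • 1) x i)

variable [NeZero n]

lemma genU_zero : genU b (fRoot (ABar.ofA (0 : A n))) = (rootSubgroup b 1).map PGL.mk := by
  rw [genU_fRoot, coords_zero]

lemma exists_isometry_of_mem_U0hat {u : PGL K V} (hu : u ∈ U0hat b) :
    ∃ g : LinearMap.GeneralLinearGroup K V, PGL.mk g = u ∧
      ∀ x, wnorm b 1 (g.val x) = wnorm b 1 x := by
  obtain ⟨u, hu, _, ⟨d, rfl, hd⟩, rfl⟩ := hu
  rw [genU_zero] at hu
  obtain ⟨u, hu, rfl⟩ := hu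
  -- Membership in `Z` says that all entries have the same valuation; dividing by one of them turns
  -- them into units without changing the class.
  let e : Fin n → Kˣ := fun i => (d 0)⁻¹ * d i
  have he : ∀ i, absK (e i : K) = 1 := fun i => by
    have h1 : negVal d i = negVal d 0 :=
      (Submodule.Quotient.mk_eq_zero _).1 hd i (Finset.mem_univ i) 0 (Finset.mem_univ 0)
    have h2 : absK (d i : K) = absK (d 0 : K) := by
      rw [absK_of_ne_zero (d i).ne_zero, absK_of_ne_zero (d 0).ne_zero]
      exact congrArg Real.exp h1
    simp only [e, Units.val_mul, Units.val_inv_eq_inv_val]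
    rw [absK_mul, absK_inv, h2, inv_mul_cancel₀ (absK_pos (d 0).ne_zero).ne']
  refine ⟨u * monoGL b e 1, ?_, fun x => ?_⟩
  · rw [map_mul]
    exact congrArg _ (mono_smul b _ d 1)
  · have h1 : monoWeight e 1 (1 : Fin n → ℝ) = 1 := by
      funext k
      simp [monoWeight, he]
    rw [Units.val_mul, Module.End.mul_apply, wnorm_rootSubgroup b zero_le_one hu]
    conv_rhs => rw [← wnorm_monoGL b zero_le_one e 1, h1]

/-- Elimination applied to the standard norm gives a monomial factor with unit entries, whose
permutation part is absorbed into root elements up to signs. With the previous lemma, `U_0^∧` is the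
image of the stabilizer of the standard norm. -/
lemma mk_mem_U0hat {g : LinearMap.GeneralLinearGroup K V}
    (hg : ∀ x, wnorm b 1 (g.val x) = wnorm b 1 x) : PGL.mk g ∈ U0hat b := by
  obtain ⟨u, hu, d, w, rfl, hw⟩ := exists_eq_mul_monoGL b (p := 1) (q := 1) zero_le_one
    zero_le_one g one_pos (by simpa using hg)
  have hd : ∀ i, absK (d i : K) = 1 := fun i => by
    simpa [monoWeight] using congrFun hw i
  obtain ⟨u', hu', e, he, h⟩ := exists_monoGL_eq_mul_diag b d w hd
  rw [h, ← mul_assoc, map_mul]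
  refine Set.mul_mem_mul ?_ ⟨e, rfl, ?_⟩
  · rw [genU_zero]
    exact ⟨u * u', mul_mem hu hu', rfl⟩
  · have : negVal e = 0 := funext fun i => by
      simp [negVal, (vInt_eq_zero_iff (e i).ne_zero).2 (he i)]
    rw [this, map_zero]

lemma isCompact_U0hat : IsCompact (U0hat b) := by
  -- Pairs of integral matrices inverse to each other: a closed subset of a compact set. Recording
  -- the inverse matches the topology on units, in which inversion must be continuous.
  let C : Set (Matrix (Fin n) (Fin n) K × Matrix (Fin n) (Fin n) K) :=
    {x | (∀ i j, absK (x.1 i j) ≤ 1 ∧ absK (x.2 i j) ≤ 1) ∧ x.1 * x.2 = 1 ∧ x.2 * x.1 = 1}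
  have hball : IsCompact {a : Matrix (Fin n) (Fin n) K | ∀ i j, absK (a i j) ≤ 1} := by
    have h := isCompact_univ_pi fun _ : Fin n => isCompact_univ_pi fun _ : Fin n =>
      isCompact_absK_le_one (K := K)
    change IsCompact {a : Fin n → Fin n → K | ∀ i j, absK (a i j) ≤ 1}
    convert h using 1
    ext a
    simp [Set.mem_pi]
  have : T1Space K := by
    refine IsTopologicalAddGroup.t1Space K ?_
    have : ({0} : Set K) = absK ⁻¹' {0} := by
      ext x
      simp [absK_eq_zero]
    rw [this]
    exact isClosed_singleton.preimage continuous_absK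
  have hC : IsCompact C := by
    refine (hball.prod hball).of_isClosed_subset ?_ fun x hx =>
      ⟨fun i j => (hx.1 i j).1, fun i j => (hx.1 i j).2⟩
    refine IsClosed.inter (s₁ := {x : Matrix (Fin n) (Fin n) K × Matrix (Fin n) (Fin n) K |
      ∀ i j, absK (x.1 i j) ≤ 1 ∧ absK (x.2 i j) ≤ 1}) ?_
      (IsClosed.inter (isClosed_eq (continuous_fst.matrix_mul continuous_snd) continuous_const)
        (isClosed_eq (continuous_snd.matrix_mul continuous_fst) continuous_const))
    have h1 : ∀ i j, Continuous fun a : Matrix (Fin n) (Fin n) K => absK (a i j) := fun i j =>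
      continuous_absK.comp (Continuous.matrix_elem continuous_id i j)
    simp only [Set.ofPred_forall]
    exact isClosed_iInter fun i => isClosed_iInter fun j =>
      (isClosed_le ((h1 i j).comp continuous_fst) continuous_const).inter
        (isClosed_le ((h1 i j).comp continuous_snd) continuous_const)
  have hCs : CompactSpace C := isCompact_iff_compactSpace.1 hC
  let T := Matrix.toLin b b
  have hT : ∀ a c, T (a * c) = T a * T c := fun a c => Matrix.toLin_mul b b b a c
  have hTone : T 1 = 1 := Matrix.toLin_one b
  let f : C → LinearMap.GeneralLinearGroup K V := fun x =>
    ⟨T x.1.1, T x.1.2, by rw [← hT, x.2.2.1, hTone], by rw [← hT, x.2.2.2, hTone]⟩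
  have hf : @Continuous _ _ _ (glTopology K V) f := by
    let _ : TopologicalSpace (V →ₗ[K] V) := moduleTopology K (V →ₗ[K] V)
    have : IsModuleTopology K (V →ₗ[K] V) := ⟨rfl⟩
    have : IsModuleTopology K (Matrix (Fin n) (Fin n) K) :=
      inferInstanceAs (IsModuleTopology K (Fin n → Fin n → K))
    have : ContinuousAdd (V →ₗ[K] V) := IsModuleTopology.toContinuousAdd K _
    have h1 : Continuous T := IsModuleTopology.continuous_of_linearMap T.toLinearMap
    refine Units.continuous_iff.2 ⟨?_, ?_⟩
    · exact h1.comp (continuous_fst.comp continuous_subtype_val)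
    · exact h1.comp (continuous_snd.comp continuous_subtype_val)
  have hmk : Continuous fun x : C => (PGL.mk (f x) : PGL K V) := by
    let _ := glTopology K V
    exact (continuous_coinduced_rng (f := (PGL.mk : _ → PGL K V))).comp hf
  have hTe : ∀ a i j, b.repr (T a (b j)) i = a i j := fun a i j => by
    have := LinearMap.toMatrix_apply b b (T a) i j
    rw [LinearMap.toMatrix_toLin] at this
    exact this.symm
  have hrange : U0hat b = Set.range fun x : C => (PGL.mk (f x) : PGL K V) := by
    ext u
    constructor
    · intro hu
      obtain ⟨g, rfl, hg⟩ := exists_isometry_of_mem_U0hat b hu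
      have hinv := wnorm_one_inv b hg
      refine ⟨⟨(LinearMap.toMatrix b b g.val, LinearMap.toMatrix b b (g⁻¹).val), ?_, ?_, ?_⟩, ?_⟩
      · intro i j
        change absK (LinearMap.toMatrix b b g.val i j) ≤ 1 ∧
          absK (LinearMap.toMatrix b b (g⁻¹).val i j) ≤ 1
        rw [LinearMap.toMatrix_apply, LinearMap.toMatrix_apply]
        exact ⟨entry_le_one b hg i j, entry_le_one b hinv i j⟩
      · change LinearMap.toMatrix b b g.val * LinearMap.toMatrix b b (g⁻¹).val = 1
        rw [← LinearMap.toMatrix_mul, ← Units.val_mul, mul_inv_cancel, Units.val_one,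
          LinearMap.toMatrix_one]
      · change LinearMap.toMatrix b b (g⁻¹).val * LinearMap.toMatrix b b g.val = 1
        rw [← LinearMap.toMatrix_mul, ← Units.val_mul, inv_mul_cancel, Units.val_one,
          LinearMap.toMatrix_one]
      · refine congrArg PGL.mk (Units.ext ?_)
        exact Matrix.toLin_toMatrix b b g.val
    · rintro ⟨x, rfl⟩
      refine mk_mem_U0hat b fun y => le_antisymm
        (wnorm_one_le_of_entries b (fun i j => ?_) y) ?_
      · exact (hTe x.1.1 i j).symm ▸ (x.2.1 i j).1
      · have h := wnorm_one_le_of_entries b (g := ((f x)⁻¹).val)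
          (fun i j => (hTe x.1.2 i j).symm ▸ (x.2.1 i j).2) ((f x).val y)
        rwa [← Module.End.mul_apply, ← Units.val_mul, inv_mul_cancel] at h
  rw [hrange]
  exact isCompact_range hmk

instance : CompactSpace (U0hat b) := isCompact_iff_compactSpace.1 (isCompact_U0hat b)

/-! ### The compactification as a closed set of seminorms. -/

instance : CompactSpace (XBar b) := inferInstanceAs (CompactSpace (Quot (relXBar b)))

/-- The embedding of the compactification into the functions on `V`. -/
def XBar.toSeminorm : XBar b → V → ℝ :=
  Quot.lift (fun p => normalized b p.1 p.2) fun _ _ h => (normalized_eq_iff b _ _ _ _).2 h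

lemma XBar.toSeminorm_mk (u : U0hat b) (ξ : ABar n) :
    XBar.toSeminorm b (XBar.mk b u ξ) = normalized b u ξ := rfl

lemma XBar.exists_eq_mk (ξ : XBar b) : ∃ u x, ξ = XBar.mk b u x := by
  obtain ⟨u, x⟩ := ξ
  exact ⟨u, x, rfl⟩

lemma XBar.continuous_toSeminorm : Continuous (XBar.toSeminorm b) := by
  have h : Continuous fun p : U0hat b × ABar n => ((p.1 : PGL K V), p.2) :=
    (continuous_subtype_val.comp continuous_fst).prodMk continuous_snd
  have h' := (continuous_normalized b).comp h
  rw [Function.comp_def] at h'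
  exact continuous_quot_lift _ h'

lemma XBar.toSeminorm_injective : Function.Injective (XBar.toSeminorm b) := by
  rintro ⟨p⟩ ⟨q⟩ h
  exact Quot.sound ((normalized_eq_iff b _ _ _ _).1 h)

instance : T2Space (XBar b) :=
  T2Space.of_injective_continuous (XBar.toSeminorm_injective b) (XBar.continuous_toSeminorm b)

lemma XBar.isClosedEmbedding_toSeminorm : IsClosedEmbedding (XBar.toSeminorm b) :=
  (XBar.continuous_toSeminorm b).isClosedEmbedding (XBar.toSeminorm_injective b)

/-! ### The building inside the compactification. -/

/-- The map of the building to the functions on `V`. -/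
def X.toSeminorm : X b → V → ℝ :=
  Quot.lift (fun p => normalized b p.1 (ABar.ofA p.2)) fun p _ ⟨m, hm, h⟩ =>
    (normalized_eq_iff b _ _ _ _).2 ⟨m, hm, PA_eq b p.2 ▸ h⟩

lemma X.continuous_toSeminorm : Continuous (X.toSeminorm b) := by
  have h : Continuous fun p : PGL K V × A n => (p.1, ABar.ofA p.2) :=
    continuous_fst.prodMk (isOpenEmbedding_ofA.continuous.comp continuous_snd)
  have h' := (continuous_normalized b).comp h
  rw [Function.comp_def] at h'
  exact continuous_quot_lift _ h'

lemma X.toSeminorm_injective : Function.Injective (X.toSeminorm b) := by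
  rintro ⟨p⟩ ⟨q⟩ h
  obtain ⟨m, hm, h⟩ := (normalized_eq_iff b _ _ _ _).1 h
  exact Quot.sound ⟨m, hm, (PA_eq b p.2).symm ▸ h⟩

lemma exists_nu_ofA_eq (m : N b) (x : A n) : ∃ y : A n, nu b m (ABar.ofA x) = ABar.ofA y := by
  obtain ⟨⟨d, w⟩, hm⟩ := exists_mono b m
  obtain rfl : m = ⟨mono b d w, mono_mem_N b d w⟩ := Subtype.ext hm
  have : nu b ⟨mono b d w, mono_mem_N b d w⟩ (ABar.ofA x) ∈ Set.range ABar.ofA := by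
    rw [nu_mono, mem_range_ofA_iff]
    intro i
    rw [coords_monoAct]
    exact mul_pos (inv_pos.2 (norm_pos_iff.2 (monoWeight_ne_zero d w (coords_ne_zero _))))
      (mul_pos (inv_pos.2 (absK_pos (d i).ne_zero)) (mem_range_ofA_iff.1 ⟨x, rfl⟩ _))
  obtain ⟨y, hy⟩ := this
  exact ⟨y, hy.symm⟩

/-- Every point of the building is the class of a pair in `U_0^∧ × A`. -/
lemma exists_toSeminorm_eq (ξ : X b) : ∃ (u : U0hat b) (x : A n),
    XBar.toSeminorm b (XBar.mk b u (ABar.ofA x)) = X.toSeminorm b ξ := by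
  obtain ⟨g, x⟩ := ξ
  obtain ⟨g, rfl⟩ := PGL.mk_surjective g
  -- With `g = u m u'` and `u'` fixing the seminorm of `x`, the pair `(g, x)` is equivalent to `(u,
  -- m x)`, where `u` is integral.
  obtain ⟨u, hu, u', hu', d, w, rfl⟩ :=
    exists_cartan b (mem_range_ofA_iff.1 ⟨x, rfl⟩) g
  let m : N b := ⟨mono b d w, mono_mem_N b d w⟩
  obtain ⟨y, hy⟩ := exists_nu_ofA_eq b m x
  refine ⟨⟨PGL.mk u, mk_mem_U0hat b (wnorm_rootSubgroup b zero_le_one hu)⟩, y,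
    ((normalized_eq_iff b _ _ _ _).2 ⟨m, hy, ?_⟩).symm⟩
  change (PGL.mk (u * monoGL b d w * u'))⁻¹ * PGL.mk u * PGL.mk (monoGL b d w) ∈ _
  rw [← map_inv, ← map_mul, ← map_mul]
  have : (u * monoGL b d w * u')⁻¹ * u * monoGL b d w = u'⁻¹ := by group
  rw [this]
  exact mk_mem_PBar b (inv_mem hu')

/-- The embedding of the building into its compactification. -/
def X.toXBar (ξ : X b) : XBar b :=
  XBar.mk b (exists_toSeminorm_eq b ξ).choose
    (ABar.ofA (exists_toSeminorm_eq b ξ).choose_spec.choose)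

lemma toSeminorm_toXBar (ξ : X b) : XBar.toSeminorm b (X.toXBar b ξ) = X.toSeminorm b ξ :=
  (exists_toSeminorm_eq b ξ).choose_spec.choose_spec

/-- The representatives chosen in `X.toXBar` do not matter, since the seminorm determines the point.
-/
lemma X.toXBar_mk (u : U0hat b) (x : A n) :
    X.toXBar b (X.mk b u x) = XBar.mk b u (ABar.ofA x) :=
  XBar.toSeminorm_injective b (toSeminorm_toXBar b _)

lemma X.range_toXBar : Set.range (X.toXBar b) =
    {p | ∃ (u : U0hat b) (x : A n), p = XBar.mk b u (ABar.ofA x)} := by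
  ext p
  constructor
  · rintro ⟨ξ, rfl⟩
    exact ⟨_, _, rfl⟩
  · rintro ⟨u, x, rfl⟩
    exact ⟨_, X.toXBar_mk b u x⟩

lemma X.toXBar_injective : Function.Injective (X.toXBar b) := fun ξ η h =>
  X.toSeminorm_injective b (by rw [← toSeminorm_toXBar, h, toSeminorm_toXBar])

lemma X.continuous_toXBar : Continuous (X.toXBar b) := by
  rw [(XBar.isClosedEmbedding_toSeminorm b).isInducing.continuous_iff]
  have : XBar.toSeminorm b ∘ X.toXBar b = X.toSeminorm b := funext (toSeminorm_toXBar b)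
  rw [this]
  exact X.continuous_toSeminorm b

lemma X.continuous_mk : Continuous fun p : U0hat b × A n => X.mk b p.1 p.2 :=
  continuous_quot_mk.comp
    ((continuous_subtype_val.comp continuous_fst).prodMk continuous_snd)

/-- Openness is tested on `U_0^∧ × ABar`, where the preimage of the image of `W` is an open subset
of `U_0^∧ × A`. -/
lemma X.isOpenMap_toXBar : IsOpenMap (X.toXBar b) := by
  intro W hW
  have hpre : (fun p : U0hat b × ABar n => XBar.mk b p.1 p.2) ⁻¹' (X.toXBar b '' W) =
      Prod.map id ABar.ofA '' ((fun p : U0hat b × A n => X.mk b p.1 p.2) ⁻¹' W) := by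
    ext ⟨u, ξ⟩
    constructor
    · rintro ⟨η, hη, h⟩
      obtain ⟨u', x', hx'⟩ : ∃ (u' : U0hat b) (x' : A n),
          X.toXBar b η = XBar.mk b u' (ABar.ofA x') := ⟨_, _, rfl⟩
      have h1 : normalized b u' (ABar.ofA x') = normalized b u ξ :=
        congrArg (XBar.toSeminorm b) (hx'.symm.trans h)
      -- As `N` preserves `A`, a pair equivalent to one over `A` lies itself over `A`.
      obtain ⟨m, hm, -⟩ := (normalized_eq_iff b _ _ _ _).1 h1
      obtain ⟨y, hy⟩ := exists_nu_ofA_eq b m x'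
      obtain rfl : ξ = ABar.ofA y := hm.symm.trans hy
      refine ⟨(u, y), ?_, rfl⟩
      have : X.mk b u y = η := X.toXBar_injective b ((X.toXBar_mk b u y).trans h.symm)
      exact (this ▸ hη : X.mk b u y ∈ W)
    · rintro ⟨⟨u', x'⟩, hW', h⟩
      obtain ⟨rfl, rfl⟩ := Prod.mk.inj h
      exact ⟨_, hW', X.toXBar_mk b u' x'⟩
  refine isOpen_coinduced.2 ?_
  change IsOpen ((fun p : U0hat b × ABar n => XBar.mk b p.1 p.2) ⁻¹' (X.toXBar b '' W))
  rw [hpre]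
  exact (IsOpenMap.id.prodMap isOpenEmbedding_ofA.isOpenMap) _ (hW.preimage (X.continuous_mk b))

lemma X.isOpenEmbedding_toXBar : IsOpenEmbedding (X.toXBar b) :=
  .of_continuous_injective_isOpenMap (X.continuous_toXBar b) (X.toXBar_injective b)
    (X.isOpenMap_toXBar b)

lemma X.denseRange_toXBar : DenseRange (X.toXBar b) := by
  have h1 : DenseRange (Quot.mk (relXBar b) ∘ Prod.map (id : U0hat b → U0hat b) ABar.ofA) :=
    Quot.mk_surjective.denseRange.comp
      (Function.surjective_id.denseRange.prodMap denseRange_ofA) continuous_quot_mk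
  refine Dense.mono ?_ h1
  rintro _ ⟨⟨u, x⟩, rfl⟩
  exact ⟨_, X.toXBar_mk b u x⟩

/-! ### The contraction -/

/-- For an integral isometry the denominator is 1: weights of sup norm 1 are dominated by the
standard norm, and applying `wnorm_map_le` to `g v_i` shows that the maximum on the basis is at
least each weight. -/
lemma normalized_of_isometry {g : LinearMap.GeneralLinearGroup K V}
    (hg : ∀ x, wnorm b 1 (g.val x) = wnorm b 1 x) (ξ : ABar n) (x : V) :
    normalized b (PGL.mk g) ξ x = wnorm b (coords ξ) ((g⁻¹).val x) := by
  have hinv := wnorm_one_inv b hg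
  have hle : ∀ y, wnorm b (coords ξ) y ≤ wnorm b 1 y := fun y =>
    (wnorm_le_iff b (coords_nonneg ξ) (wnorm_nonneg _ _ _)).2 fun i => by
      refine le_trans (mul_le_mul_of_nonneg_left ?_ (absK_nonneg _)) (le_wnorm b 1 y i)
      rw [Pi.one_apply, ← norm_coords ξ]
      exact (le_abs_self _).trans (norm_le_pi_norm (coords ξ) i)
  have h1 : ‖fun j => wnorm b (coords ξ) ((g⁻¹).val (b j))‖ = 1 := by
    refine le_antisymm ((pi_norm_le_iff_of_nonneg zero_le_one).2 fun j => ?_) ?_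
    · rw [Real.norm_of_nonneg (wnorm_nonneg _ _ _)]
      refine (hle _).trans ?_
      rw [hinv, wnorm_basis b zero_le_one, Pi.one_apply]
    · rw [← norm_coords ξ]
      refine (pi_norm_le_iff_of_nonneg (norm_nonneg _)).2 fun i => ?_
      rw [Real.norm_of_nonneg (coords_nonneg ξ i)]
      have h := wnorm_map_le b (coords_nonneg ξ) (g⁻¹).val (g.val (b i))
      rw [hg, wnorm_basis b zero_le_one, Pi.one_apply, one_mul, ← Module.End.mul_apply,
        ← Units.val_mul, inv_mul_cancel] at h
      rwa [Units.val_one, Module.End.one_apply, wnorm_basis b (coords_nonneg ξ)] at h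
  rw [normalized_mk, normalizedGL, h1, div_one]

/-- With the same `u`, replace the weights `p` by `max(p, t)`. Their sup norm remains 1 because `t ≤
1`, and `u` leaves the standard norm unchanged, so no renormalization occurs. -/
lemma exists_toSeminorm_eq_max (ξ : XBar b) (t : unitInterval) : ∃ η : XBar b,
    XBar.toSeminorm b η = fun x => max (XBar.toSeminorm b ξ x) (t * wnorm b 1 x) := by
  obtain ⟨u, ξ, rfl⟩ := XBar.exists_eq_mk b ξ
  obtain ⟨g, hgu, hg⟩ := exists_isometry_of_mem_U0hat b u.2
  have ht := t.2.1
  have hq : (0 : Fin n → ℝ) ≤ coords ξ ⊔ (t : ℝ) • 1 := (coords_nonneg ξ).trans le_sup_left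
  have hle : ‖coords ξ ⊔ (t : ℝ) • (1 : Fin n → ℝ)‖ ≤ 1 :=
    (pi_norm_le_iff_of_nonneg zero_le_one).2 fun i => by
      rw [Real.norm_of_nonneg (hq i)]
      refine max_le ?_ (by simpa using t.2.2)
      rw [← norm_coords ξ]
      exact (le_abs_self _).trans (norm_le_pi_norm (coords ξ) i)
  have hge : 1 ≤ ‖coords ξ ⊔ (t : ℝ) • (1 : Fin n → ℝ)‖ := by
    rw [← norm_coords ξ]
    refine (pi_norm_le_iff_of_nonneg (norm_nonneg _)).2 fun i => ?_
    rw [Real.norm_of_nonneg (coords_nonneg ξ i)]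
    exact (le_max_left _ _).trans ((le_abs_self _).trans
      (norm_le_pi_norm (coords ξ ⊔ (t : ℝ) • (1 : Fin n → ℝ)) i))
  have hn := le_antisymm hle hge
  have hc : coords (ofWeight (coords ξ ⊔ (t : ℝ) • 1)) = coords ξ ⊔ (t : ℝ) • 1 := by
    rw [coords_ofWeight hq (by intro h; simp [h] at hn), unitize_of_norm hn]
  refine ⟨XBar.mk b u (ofWeight (coords ξ ⊔ (t : ℝ) • 1)), funext fun x => ?_⟩
  rw [XBar.toSeminorm_mk, XBar.toSeminorm_mk, ← hgu, normalized_of_isometry b hg,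
    normalized_of_isometry b hg, hc,
    wnorm_sup b _ (coords_nonneg ξ) ht, wnorm_one_inv b hg]

instance : ContractibleSpace (XBar b) := by
  choose H hH using exists_toSeminorm_eq_max b
  have h1 : ∀ (ξ : XBar b) x, 0 ≤ XBar.toSeminorm b ξ x ∧ XBar.toSeminorm b ξ x ≤ wnorm b 1 x := by
    intro ξ x
    obtain ⟨u, ξ, rfl⟩ := XBar.exists_eq_mk b ξ
    obtain ⟨g, hgu, hg⟩ := exists_isometry_of_mem_U0hat b u.2
    rw [XBar.toSeminorm_mk, ← hgu, normalized_of_isometry b hg]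
    refine ⟨wnorm_nonneg _ _ _, ?_⟩
    rw [← wnorm_one_inv b hg x]
    refine (wnorm_le_iff b (coords_nonneg ξ) (wnorm_nonneg _ _ _)).2 fun i => ?_
    refine le_trans (mul_le_mul_of_nonneg_left ?_ (absK_nonneg _)) (le_wnorm b 1 _ i)
    rw [Pi.one_apply, ← norm_coords ξ]
    exact (le_abs_self _).trans (norm_le_pi_norm (coords ξ) i)
  have hone : (1 : PGL K V) ∈ U0hat b := by
    rw [← map_one PGL.mk]
    exact mk_mem_U0hat b fun x => rfl
  let o : XBar b := XBar.mk b ⟨1, hone⟩ (ABar.ofA 0)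
  have ho : XBar.toSeminorm b o = wnorm b 1 := by
    funext x
    have h := normalized_of_isometry b (g := 1) (fun _ => rfl) (ABar.ofA 0) x
    rw [map_one, coords_zero] at h
    rw [XBar.toSeminorm_mk, h]
    simp
  refine (contractible_iff_id_nullhomotopic _).2 ⟨o, ⟨⟨⟨fun z => H z.2 z.1, ?_⟩, fun ξ => ?_,
    fun ξ => ?_⟩⟩⟩
  -- `H` is chosen pointwise, but its composite with the embedding is an explicit maximum, so
  -- continuity is checked at each vector `x`.
  · rw [(XBar.isClosedEmbedding_toSeminorm b).isInducing.continuous_iff]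
    refine continuous_pi fun x => ?_
    simp only [Function.comp_apply, hH]
    exact ((continuous_apply x).comp
      ((XBar.continuous_toSeminorm b).comp continuous_snd)).max
      ((continuous_subtype_val.comp continuous_fst).mul continuous_const)
  · refine XBar.toSeminorm_injective b ?_
    change XBar.toSeminorm b (H ξ 0) = XBar.toSeminorm b ξ
    rw [hH]
    funext x
    simp [(h1 ξ x).1]
  · refine XBar.toSeminorm_injective b ?_
    change XBar.toSeminorm b (H ξ 1) = XBar.toSeminorm b o
    rw [hH, ho]
    funext x
    simp [(h1 ξ x).2]

end MainTheorem

end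

end BTCompactification

theorem theorem4p1 {K : Type*} [Field K] [ValuativeRel K] [TopologicalSpace K]
    [IsNonarchimedeanLocalField K] {V : Type*} [AddCommGroup V] [Module K V]
    {n : ℕ} [NeZero n] (b : Module.Basis (Fin n) K V) :
    CompactSpace (BTCompactification.XBar b) ∧
    T2Space (BTCompactification.XBar b) ∧
    ContractibleSpace (BTCompactification.XBar b) ∧
    ∃ j : BTCompactification.X b → BTCompactification.XBar b,
      (∀ (u : BTCompactification.U0hat b) (x : BTCompactification.A n),
        j (BTCompactification.X.mk b u x) =
          BTCompactification.XBar.mk b u (BTCompactification.ABar.ofA x)) ∧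
      Set.range j = {p | ∃ (u : BTCompactification.U0hat b) (x : BTCompactification.A n),
        p = BTCompactification.XBar.mk b u (BTCompactification.ABar.ofA x)} ∧
      IsOpenEmbedding j ∧
      DenseRange j :=
  ⟨inferInstance, inferInstance, inferInstance, BTCompactification.X.toXBar b,
    BTCompactification.X.toXBar_mk b, BTCompactification.X.range_toXBar b,
    BTCompactification.X.isOpenEmbedding_toXBar b, BTCompactification.X.denseRange_toXBar b⟩
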